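/- **Setting.** Let $n\ge 1$ and let $\Gamma\subset\mathbb R^n$ be an open convex cone with vertex at the origin, invariant under permutations of the coordinates and containing the positive cone $\Gamma_n=\{\lambda:\lambda_i>0\ \forall i\}$. Let $f\in C^1(\Gamma)$ be symmetric and satisfy in $\Gamma$: (i) $\partial f/\partial\lambda_i\ge 0$ for all $i$; (ii) $f$ is concave; (iii) there is $\delta\in(0,\tfrac12)$ such that $\frac{\partial f}{\partial\lambda_j}>2\delta\sum_i\frac{\partial f}{\partial\lambda_i}$ whenever $\lambda_j<0$; (iv) for every $\lambda\in\Gamma$, $t\mapsto f(t\lambda)$ is nondecreasing on $(0,\infty)$. Assume that $f(\mathbf 0):=\limsup_{\lambda\to 0,\,\lambda\in\Gamma}f(\lambda)$ is finite. For $\lambda\in\partial\Gamma$ put $f(\lambda):=\limsup_{\lambda'\to\lambda,\ \lambda'\in\Gamma}f(\lambda')$. Let $S,K\in\mathbb R$ with (v) $\lim_{t\to+\infty}f(t,\dots,t)>S$. For a positive $C^2$ function $u$ on a domain of $\mathbb R^n$ write $w=\sqrt{1+|Du|^2}$, $\nu=(-Du/w,\,1/w)$, $\gamma^{ik}=\delta_{ik}-\frac{u_iu_k}{w(w+1)}$,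 and let $\lambda(A)\in\mathbb R^n$ be the vector of eigenvalues of the hyperbolic curvature matrix $A=(a_{ij})$ of the vertical graph of $u$ in the half-space model of $\mathbb H^{n+1}$, $$a_{ij}=\frac1w\sum_{k,l}\gamma^{ik}(\delta_{kl}+u_ku_l+u\,u_{kl})\gamma^{lj}.$$ **Theorem.** There is a constant $C>0$, depending only on $n,\Gamma,f,S,K$, with the following property. Let $r>0$, let $\Omega\subset\mathbb R^n\times\mathbb R\times\mathbb R^{n+1}$ be open, and let $\psi=\psi(x,u,\nu)\in C^1(\Omega)$ satisfy $$\psi_u-\frac{\psi-f(\mathbf 0)}{u}\ge 0\qquad\text{at all points of }\Omega\text{ with }u>0 .$$ Let $u\in C^3(B_r(0))$ be positive and bounded, with $(x,u(x),\nu(x))\in\Omega$ for all $x\in B_r(0)$, and let it be an admissible solution of the prescribed curvature equation, i.e. $\lambda(A)\in\overline\Gamma$ and $$f(\lambda(A))=\psi(x,u,\nu)\qquad\text{in }B_r(0).$$ Suppose that $\psi\le S$ and $|D\psi|\le K$ at $(x,u(x),\nu(x))$ for all $x\in B_r(0)$, where $D\psi$ is the full derivative of $\psi$ in $(x,u,\nu)$,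 measured in the operator norm with respect to the maximum of the Euclidean norms of the three components. Suppose moreover that * either $\lambda(A)\in\Gamma$ everywhere in $B_r(0)$, * or there are a function $h\in C^1(\mathbb R)$, strictly increasing, and a function $g\in C^1\big(\overline\Gamma\setminus(\partial\Gamma_n\cap\partial\Gamma)\big)$ ($C^1$ up to the boundary) with $g=h\circ f$ in $\Gamma$ and $\sum_i\partial g/\partial\lambda_i>0$ on $\partial\Gamma\setminus\partial\Gamma_n$. Then $$|Du(0)|\le\exp\Big(C\Big(M+\frac{M^2}{r^2}+1\Big)\Big),\qquad M=\sup_{B_r(0)}u .$$ -/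

import Mathlib

open Set Filter Topology

noncomputable section

namespace HypGrad

/-- The partial derivative `u_i` of `u` at `x`. -/
def pd {n : ℕ} (u : EuclideanSpace ℝ (Fin n) → ℝ) (x : EuclideanSpace ℝ (Fin n))
    (i : Fin n) : ℝ :=
  fderiv ℝ u x (EuclideanSpace.single i 1)

/-- The second partial derivative `u_{kl}` of `u` at `x`. -/
def pd2 {n : ℕ} (u : EuclideanSpace ℝ (Fin n) → ℝ) (x : EuclideanSpace ℝ (Fin n))
    (k l : Fin n) : ℝ :=
  fderiv ℝ (fderiv ℝ u) x (EuclideanSpace.single k 1) (EuclideanSpace.single l 1)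

/-- `w = √(1 + |Du|²)`. -/
def wFac {n : ℕ} (u : EuclideanSpace ℝ (Fin n) → ℝ) (x : EuclideanSpace ℝ (Fin n)) : ℝ :=
  Real.sqrt (1 + ‖gradient u x‖ ^ 2)

/-- `γ^{ik} = δ_{ik} - u_i u_k / (w (w + 1))`. -/
def gam {n : ℕ} (u : EuclideanSpace ℝ (Fin n) → ℝ) (x : EuclideanSpace ℝ (Fin n)) :
    Matrix (Fin n) (Fin n) ℝ :=
  Matrix.of fun i k =>
    (if i = k then 1 else 0) - pd u x i * pd u x k / (wFac u x * (wFac u x + 1))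

/-- The hyperbolic curvature matrix of the vertical graph of `u` in the half-space model:
`a_{ij} = (1 / w) ∑_{k,l} γ^{ik} (δ_{kl} + u_k u_l + u u_{kl}) γ^{lj}`. -/
def curvatureMatrix {n : ℕ} (u : EuclideanSpace ℝ (Fin n) → ℝ)
    (x : EuclideanSpace ℝ (Fin n)) : Matrix (Fin n) (Fin n) ℝ :=
  Matrix.of fun i j =>
    1 / wFac u x * ∑ k, ∑ l, gam u x i k *
      ((if k = l then 1 else 0) + pd u x k * pd u x l + u x * pd2 u x k l) * gam u x l j

/-- The curvature matrix is symmetric wherever `u` is `C²`. -/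
theorem curvatureMatrix_isHermitian {n : ℕ} {u : EuclideanSpace ℝ (Fin n) → ℝ}
    {x : EuclideanSpace ℝ (Fin n)} (hu : ContDiffAt ℝ 2 u x) :
    (curvatureMatrix u x).IsHermitian := by
  have hg : ∀ i k, gam u x i k = gam u x k i := by
    intro i k
    simp only [gam, Matrix.of_apply, eq_comm (a := i) (b := k), mul_comm (pd u x i)]
  have hs : ∀ k l, pd2 u x k l = pd2 u x l k := fun k l =>
    (hu.isSymmSndFDerivAt (by simp)) _ _
  ext i j
  simp only [Matrix.conjTranspose_apply, curvatureMatrix, Matrix.of_apply, star_trivial]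
  congr 1
  rw [Finset.sum_comm]
  refine Finset.sum_congr rfl fun k _ => Finset.sum_congr rfl fun l _ => ?_
  have hd : (if l = k then (1 : ℝ) else 0) = if k = l then 1 else 0 := by
    simp only [eq_comm]
  rw [hg j l, hg k i, hs l k, hd]
  ring

open Classical in
/-- The eigenvalues, with multiplicity and in some order, of a real symmetric matrix
(junk value `0` for a matrix that is not symmetric). -/
def eigs {n : ℕ} (A : Matrix (Fin n) (Fin n) ℝ) : Fin n → ℝ :=
  if h : A.IsHermitian then h.eigenvalues else 0

/-- The principal curvatures `λ(A)` of the vertical graph of `u` at `x`. -/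
def curvatures {n : ℕ} (u : EuclideanSpace ℝ (Fin n) → ℝ) (x : EuclideanSpace ℝ (Fin n)) :
    Fin n → ℝ :=
  eigs (curvatureMatrix u x)

/-- The upward Euclidean unit normal `ν = (- Du / w, 1 / w)`. -/
def normal {n : ℕ} (u : EuclideanSpace ℝ (Fin n) → ℝ) (x : EuclideanSpace ℝ (Fin n)) :
    EuclideanSpace ℝ (Fin (n + 1)) :=
  WithLp.toLp 2 (Fin.snoc (α := fun _ => ℝ) (fun i => -pd u x i / wFac u x) (1 / wFac u x))

/-- The point `(x, u(x), ν(x))` at which `ψ` is evaluated. -/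
def jet {n : ℕ} (u : EuclideanSpace ℝ (Fin n) → ℝ) (x : EuclideanSpace ℝ (Fin n)) :
    EuclideanSpace ℝ (Fin n) × ℝ × EuclideanSpace ℝ (Fin (n + 1)) :=
  (x, u x, normal u x)

/-- The positive cone `Γ_n`. -/
def posCone (n : ℕ) : Set (Fin n → ℝ) := {v | ∀ i, 0 < v i}

/-- `Γ` is an open symmetric convex cone with vertex at the origin containing `Γ_n`. -/
structure IsSymmCone {n : ℕ} (Γ : Set (Fin n → ℝ)) : Prop where
  isOpen : IsOpen Γ
  convex : Convex ℝ Γ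
  cone : ∀ v ∈ Γ, ∀ t : ℝ, 0 < t → t • v ∈ Γ
  symm : ∀ v ∈ Γ, ∀ σ : Equiv.Perm (Fin n), v ∘ σ ∈ Γ
  posCone_subset : posCone n ⊆ Γ

/-- `∂f/∂λ_i` at a point of an open set on which `f` is `C¹`. -/
def dlam {n : ℕ} (f : (Fin n → ℝ) → ℝ) (v : Fin n → ℝ) (i : Fin n) : ℝ :=
  fderiv ℝ f v (Pi.single i 1)

/-- `f` is a symmetric `C¹` function on `Γ` with the structure conditions (i)-(iv). -/
structure IsCurvatureFunction {n : ℕ} (Γ : Set (Fin n → ℝ)) (f : (Fin n → ℝ) → ℝ) :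
    Prop where
  contDiffOn : ContDiffOn ℝ 1 f Γ
  symm : ∀ v ∈ Γ, ∀ σ : Equiv.Perm (Fin n), f (v ∘ σ) = f v
  deriv_nonneg : ∀ v ∈ Γ, ∀ i, 0 ≤ dlam f v i
  concave : ConcaveOn ℝ Γ f
  neg_deriv : ∃ δ : ℝ, 0 < δ ∧ δ < 1 / 2 ∧
    ∀ v ∈ Γ, ∀ j, v j < 0 → 2 * δ * ∑ i, dlam f v i < dlam f v j
  monotone_ray : ∀ v ∈ Γ, MonotoneOn (fun t : ℝ => f (t • v)) (Ioi 0)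

/-- The limit of `f (t, …, t)` as `t → +∞` exists (possibly `+∞`) and exceeds `S`. -/
def DiagLimitGT {n : ℕ} (f : (Fin n → ℝ) → ℝ) (S : ℝ) : Prop :=
  ∃ ℓ : EReal, Tendsto (fun t : ℝ => ((f (fun _ => t) : ℝ) : EReal)) atTop (𝓝 ℓ) ∧
    (S : EReal) < ℓ

open Classical in
/-- The value of `f` at a point of the closure of `Γ`: `f v` for `v ∈ Γ`, and
`limsup f(v')` as `v' → v`, `v' ∈ Γ`, for a boundary point `v`. -/
def extVal {n : ℕ} (Γ : Set (Fin n → ℝ)) (f : (Fin n → ℝ) → ℝ) (v : Fin n → ℝ) : EReal :=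
  if v ∈ Γ then ((f v : ℝ) : EReal) else limsup (fun v' => ((f v' : ℝ) : EReal)) (𝓝[Γ] v)

/-- `closure Γ` without the common boundary points of `Γ` and of the positive cone. -/
def regSet {n : ℕ} (Γ : Set (Fin n → ℝ)) : Set (Fin n → ℝ) :=
  closure Γ \ (frontier (posCone n) ∩ frontier Γ)

/-- The pair `(g, h)` used where `λ(A)` may reach the boundary of `Γ`: `g = h ∘ f` in `Γ`,
`h` is strictly increasing and `C¹` on `ℝ`, `g` is `C¹` up to the boundary of `Γ` off the
boundary of the positive cone, and `∑ ∂g/∂λ_i > 0` there. -/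
structure IsAuxPair {n : ℕ} (Γ : Set (Fin n → ℝ)) (f g : (Fin n → ℝ) → ℝ) (h : ℝ → ℝ) :
    Prop where
  strictMono : StrictMono h
  contDiff : ContDiff ℝ 1 h
  contDiffOn : ContDiffOn ℝ 1 g (regSet Γ)
  eq_comp : ∀ v ∈ Γ, g v = h (f v)
  sum_deriv_pos : ∀ v ∈ frontier Γ \ frontier (posCone n),
    0 < ∑ i, fderivWithin ℝ g (regSet Γ) v (Pi.single i 1)

end HypGrad

end

open Set Filter Topology

noncomputable section

namespace HypGrad

/-! The proof is a Bernstein argument. At an interior maximum of a cutoff times a weighted `log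
|Du|`, the equation is differentiated in the direction `e = Du / |Du|`, and the third derivatives of
`u` are eliminated with the second order condition.

The curvatures may lie on `∂Γ`, where `f` has no gradient. The gradient is replaced by a normal `(F,
α)` of the hypograph, a limit of gradients normalised to trace one (`exists_normal`). For a
symmetric concave `f`, passing from eigenvalues to diagonal entries in a fixed orthonormal basis
does not decrease `f` (Birkhoff, `IsCurvatureFunction.le_of_mem_doublyStochastic`). Hence the
supporting inequality becomes an equality at the point that persists as an inequality nearby, and
its derivative vanishes there: this is the linearized equation (`IsSolution.exists_linearized`). Its
terms of order `p / u`, `p = |Du|`, have a good sign because `∑ F i * l i ≤ α * (ψ - f₀)` by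
concavity and `ψ_u ≥ (ψ - f₀) / u`.

The outcome (`IsSolution.key_inequality`) has two good terms, `1 / u` from the hyperbolic metric and
`(u / 4) * ∑ F i * V i ^ 2`, where the `V i` are the components of `γ D log u_e`. If the weight
`φ(u)` increases fast enough, the first order condition makes `D log u_e` large in the direction
`-e`. This forces negative curvatures, and condition (iii) gives `F i ≥ 2δ` at those indices, so the
second term is large.

With `σ = √(u / M)` and `L = log |Du|`, the weight `1 + σ` serves where `L * σ ≥ θ` and the second
good term wins (`false_of_fast_regime`). Where `L * σ ≤ θ` the constant weight is used and `1 / u`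
wins (`false_of_slow_regime`). The maximum of the two test functions switches between them exactly
at `L * σ = θ`. -/

/-! ### Second order calculus in one variable and concavity -/

/-- `f` is twice differentiable at `x`, with first and second derivatives `b` and `c`. -/
def HasJetAt (f : ℝ → ℝ) (x b c : ℝ) : Prop :=
  ∃ f' : ℝ → ℝ, (∀ᶠ t in 𝓝 x, HasDerivAt f (f' t) t) ∧ f' x = b ∧ HasDerivAt f' c x

theorem HasJetAt.continuousAt {f : ℝ → ℝ} {x b c : ℝ} (h : HasJetAt f x b c) :
    ContinuousAt f x := by
  obtain ⟨f', h1, -, -⟩ := h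
  exact h1.self_of_nhds.continuousAt

theorem HasJetAt.mul {f g : ℝ → ℝ} {x b c b' c' : ℝ} (hf : HasJetAt f x b c)
    (hg : HasJetAt g x b' c') :
    HasJetAt (fun t => f t * g t) x (b * g x + f x * b') (c * g x + 2 * b * b' + f x * c') := by
  obtain ⟨f', h1, rfl, h3⟩ := hf
  obtain ⟨g', k1, rfl, k3⟩ := hg
  refine ⟨fun t => f' t * g t + f t * g' t, ?_, rfl, ?_⟩
  · filter_upwards [h1, k1] with t ht kt using ht.mul kt
  · exact ((h3.mul k1.self_of_nhds).add (h1.self_of_nhds.mul k3)).congr_deriv (by ring)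

theorem HasJetAt.sub_const {f : ℝ → ℝ} {x b c : ℝ} (hf : HasJetAt f x b c) (k : ℝ) :
    HasJetAt (fun t => f t - k) x b c := by
  obtain ⟨f', h1, h2, h3⟩ := hf
  refine ⟨f', ?_, h2, h3⟩
  filter_upwards [h1] with t ht using ht.sub_const k

theorem HasJetAt.comp {φ f : ℝ → ℝ} {x b c b' c' : ℝ} (hφ : HasJetAt φ (f x) b' c')
    (hf : HasJetAt f x b c) :
    HasJetAt (fun t => φ (f t)) x (b' * b) (c' * b ^ 2 + b' * c) := by
  have hcont := hf.continuousAt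
  obtain ⟨f', h1, rfl, h3⟩ := hf
  obtain ⟨φ', k1, rfl, k3⟩ := hφ
  refine ⟨fun t => φ' (f t) * f' t, ?_, rfl, ?_⟩
  · filter_upwards [h1, hcont.eventually k1] with t ht kt using kt.comp t ht
  · exact ((k3.comp x h1.self_of_nhds).mul h3).congr_deriv (by simp only [Function.comp]; ring)

theorem hasJetAt_log {x : ℝ} (hx : 0 < x) : HasJetAt Real.log x x⁻¹ (-(x ^ 2)⁻¹) := by
  refine ⟨fun t => t⁻¹, ?_, rfl, hasDerivAt_inv hx.ne'⟩
  filter_upwards [lt_mem_nhds hx] with t ht using Real.hasDerivAt_log ht.ne'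

theorem hasJetAt_const (k x : ℝ) : HasJetAt (fun _ => k) x 0 0 :=
  ⟨fun _ => 0, Eventually.of_forall fun t => hasDerivAt_const t k, rfl, hasDerivAt_const x 0⟩

theorem HasJetAt.of_isLocalMax {f : ℝ → ℝ} {x b c : ℝ} (hf : HasJetAt f x b c)
    (hmax : IsLocalMax f x) : b = 0 ∧ c ≤ 0 := by
  have hcont := hf.continuousAt
  obtain ⟨f', h1, rfl, h3⟩ := hf
  have h0 : f' x = 0 := hmax.hasDerivAt_eq_zero h1.self_of_nhds
  refine ⟨h0, ?_⟩
  by_contra! hc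
  have hd : deriv f =ᶠ[𝓝 x] f' := by
    filter_upwards [h1] with t ht using ht.deriv
  have hdd : deriv (deriv f) x = c := by rw [hd.deriv_eq, h3.deriv]
  -- A positive second derivative would make `x` a local minimum too, so `f` would be locally
  -- constant and the second derivative zero.
  have hmin : IsLocalMin f x :=
    isLocalMin_of_deriv_deriv_pos (by rw [hdd]; exact hc) (by rw [hd.self_of_nhds, h0]) hcont
  have hconst : f =ᶠ[𝓝 x] fun _ => f x := by
    filter_upwards [hmax, hmin] with t ht kt using le_antisymm ht kt
  have : deriv f =ᶠ[𝓝 x] fun _ => 0 := by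
    filter_upwards [hconst.eventuallyEq_nhds] with t ht
    rw [ht.deriv_eq, deriv_const]
  have : deriv (deriv f) x = 0 := by rw [this.deriv_eq, deriv_const]
  linarith

/-- The gradient inequality of a concave function. -/
theorem _root_.ConcaveOn.le_add_fderiv {E : Type*} [NormedAddCommGroup E] [NormedSpace ℝ E]
    {s : Set E} {f : E → ℝ} (hf : ConcaveOn ℝ s f) {x y : E} (hx : x ∈ s) (hy : y ∈ s)
    {f' : E →L[ℝ] ℝ} (hd : HasFDerivAt f f' x) : f y ≤ f x + f' (y - x) := by
  have hc := hf.comp_affineMap (AffineMap.lineMap (k := ℝ) x y)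
  have hd' : HasDerivAt (f ∘ AffineMap.lineMap (k := ℝ) x y) (f' (y - x)) 0 := by
    have h1 : HasDerivAt (AffineMap.lineMap (k := ℝ) x y) (y - x) (0 : ℝ) :=
      AffineMap.hasDerivAt_lineMap
    refine HasFDerivAt.comp_hasDerivAt (0 : ℝ) ?_ h1
    simpa using hd
  have := hc.slope_le_of_hasDerivAt (x := 0) (y := 1) (by simpa using hx) (by simpa using hy)
    one_pos hd'
  simp only [slope_def_field, Function.comp, AffineMap.lineMap_apply_one,
    AffineMap.lineMap_apply_zero, sub_zero, div_one] at this
  linarith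

/-! ### Concavity of the curvature function and generalized normals on the closure of the cone -/

section Curvature

variable {n : ℕ} {Γ : Set (Fin n → ℝ)} {f : (Fin n → ℝ) → ℝ}

theorem IsCurvatureFunction.hasFDerivAt (hΓ : IsSymmCone Γ) (hf : IsCurvatureFunction Γ f)
    {v : Fin n → ℝ} (hv : v ∈ Γ) : HasFDerivAt f (fderiv ℝ f v) v :=
  ((hf.contDiffOn.contDiffAt (hΓ.isOpen.mem_nhds hv)).differentiableAt one_ne_zero).hasFDerivAt

theorem fderiv_eq_sum_dlam (f : (Fin n → ℝ) → ℝ) (v w : Fin n → ℝ) :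
    fderiv ℝ f v w = ∑ i, dlam f v i * w i := by
  conv_lhs => rw [pi_eq_sum_univ' w, map_sum]
  refine Finset.sum_congr rfl fun i _ => ?_
  rw [map_smul, smul_eq_mul, dlam, mul_comm]

theorem IsCurvatureFunction.le_add_sum (hΓ : IsSymmCone Γ) (hf : IsCurvatureFunction Γ f)
    {v w : Fin n → ℝ} (hv : v ∈ Γ) (hw : w ∈ Γ) :
    f w ≤ f v + ∑ i, dlam f v i * (w i - v i) := by
  have := hf.concave.le_add_fderiv hv hw (hf.hasFDerivAt hΓ hv)
  rwa [fderiv_eq_sum_dlam] at this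

theorem IsCurvatureFunction.sum_mul_self_nonneg (hΓ : IsSymmCone Γ)
    (hf : IsCurvatureFunction Γ f) {v : Fin n → ℝ} (hv : v ∈ Γ) :
    0 ≤ ∑ i, dlam f v i * v i := by
  rw [← fderiv_eq_sum_dlam]
  have h1 : HasDerivAt (fun t : ℝ => t • v) v 1 := by
    simpa using (hasDerivAt_id (1 : ℝ)).smul_const v
  have h2 : HasDerivAt (fun t : ℝ => f (t • v)) (fderiv ℝ f v v) 1 :=
    HasFDerivAt.comp_hasDerivAt (1 : ℝ) (by simpa using hf.hasFDerivAt hΓ hv) h1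
  have h3 := (hf.monotone_ray v hv).derivWithin_nonneg (x := 1)
  rwa [derivWithin_of_isOpen isOpen_Ioi (by simp), h2.deriv] at h3

theorem extVal_le
    {v : Fin n → ℝ} {c : ℝ} (h : ∀ᶠ v' in 𝓝[Γ] v, f v' ≤ c) : extVal Γ f v ≤ c := by
  unfold extVal
  split_ifs with hm
  · exact EReal.coe_le_coe_iff.2 (h.self_of_nhdsWithin hm)
  · exact limsup_le_of_le (h := h.mono fun _ hx => EReal.coe_le_coe_iff.2 hx)

theorem eventually_lt_of_extVal_lt (hΓ : IsSymmCone Γ) (hf : IsCurvatureFunction Γ f)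
    {v : Fin n → ℝ} {c : ℝ} (h : extVal Γ f v < c) : ∀ᶠ v' in 𝓝[Γ] v, f v' < c := by
  unfold extVal at h
  split_ifs at h with hm
  · exact ((hf.hasFDerivAt hΓ hm).continuousAt.eventually_lt continuousAt_const
      (EReal.coe_lt_coe_iff.1 h)).filter_mono nhdsWithin_le_nhds
  · exact (eventually_lt_of_limsup_lt h).mono fun _ hx => EReal.coe_lt_coe_iff.1 hx

/-- The tangent plane at `v` lies above the graph of `f`; let the comparison point tend to the
vertex of the cone. This is the only way `f₀` enters, and it matches the condition on `ψ_u`. -/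
theorem IsCurvatureFunction.sum_mul_self_le (hΓ : IsSymmCone Γ) (hf : IsCurvatureFunction Γ f)
    {f₀ : ℝ} (hf₀ : limsup (fun v => ((f v : ℝ) : EReal)) (𝓝[Γ] 0) = (f₀ : EReal))
    {v : Fin n → ℝ} (hv : v ∈ Γ) : ∑ i, dlam f v i * v i ≤ f v - f₀ := by
  have key : ∀ ε > 0, f₀ ≤ f v - ∑ i, dlam f v i * v i + ε := by
    intro ε hε
    rw [← EReal.coe_le_coe_iff, ← hf₀]
    refine limsup_le_of_le (h := ?_)
    have hc : ContinuousAt (fun w : Fin n → ℝ => f v + ∑ i, dlam f v i * (w i - v i)) 0 := by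
      exact Continuous.continuousAt (by fun_prop)
    have h1 : ∀ᶠ w in 𝓝[Γ] (0 : Fin n → ℝ), f v + ∑ i, dlam f v i * (w i - v i) <
        f v - ∑ i, dlam f v i * v i + ε := by
      refine (hc.eventually_lt continuousAt_const ?_).filter_mono nhdsWithin_le_nhds
      simp only [Pi.zero_apply, zero_sub, mul_neg, Finset.sum_neg_distrib]
      linarith
    filter_upwards [h1, self_mem_nhdsWithin] with w hw hwΓ
    exact EReal.coe_le_coe_iff.2 ((hf.le_add_sum hΓ hv hwΓ).trans hw.le)
  linarith [le_of_forall_pos_le_add key]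

/-- A normal `(F, α)` of the hypograph of `f` at a point of the closure of `Γ`, normalised by
`∑ F i = 1`; the hyperplane may be vertical, i.e. `α = 0`. -/
theorem exists_normal (hΓ : IsSymmCone Γ) (hf : IsCurvatureFunction Γ f)
    {f₀ : ℝ} (hf₀ : limsup (fun v => ((f v : ℝ) : EReal)) (𝓝[Γ] 0) = (f₀ : EReal))
    {S c t₀ δ : ℝ} (hc : 0 < c) (ht : 0 < t₀) (hfc : S + c ≤ f fun _ => t₀)
    (hδ : ∀ v ∈ Γ, ∀ j, v j < 0 → 2 * δ * ∑ i, dlam f v i < dlam f v j)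
    {v₀ : Fin n → ℝ} (hv₀ : v₀ ∈ closure Γ) {s : ℝ} (hs : extVal Γ f v₀ = (s : EReal))
    (hsS : s ≤ S) :
    ∃ (F : Fin n → ℝ) (α : ℝ), (∀ i, 0 ≤ F i) ∧ ∑ i, F i = 1 ∧ 0 ≤ α ∧ α ≤ 2 * t₀ / c ∧
      (∀ j, v₀ j < 0 → 2 * δ ≤ F j) ∧ 0 ≤ ∑ i, F i * v₀ i ∧
      ∑ i, F i * v₀ i ≤ α * (s - f₀) ∧
      ∀ w ∈ Γ, α * (f w - s) ≤ ∑ i, F i * (w i - v₀ i) := by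
  obtain ⟨v, hvΓ, hv⟩ := mem_closure_iff_seq_limit.1 hv₀
  have hvw : Tendsto v atTop (𝓝[Γ] v₀) :=
    tendsto_nhdsWithin_iff.2 ⟨hv, Eventually.of_forall hvΓ⟩
  have hlt : ∀ ε > 0, ∀ᶠ k in atTop, f (v k) < s + ε := fun ε hε =>
    hvw.eventually (eventually_lt_of_extVal_lt hΓ hf (by rw [hs]; exact_mod_cast (by linarith)))
  have ht₀ : (fun _ => t₀) ∈ Γ := hΓ.posCone_subset fun _ => ht
  set T : ℕ → ℝ := fun k => ∑ i, dlam f (v k) i with hT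
  -- The tangent plane at `v k`, evaluated at `(t₀, …, t₀)`, must climb from below `S + c / 2` to at
  -- least `S + c`, while its term `-∑ f_i v_i` is nonpositive.
  have hTlow : ∀ᶠ k in atTop, c / 2 ≤ t₀ * T k := by
    filter_upwards [hlt (c / 2) (by linarith)] with k hk
    have h1 := hf.le_add_sum hΓ (hvΓ k) ht₀
    have h2 := hf.sum_mul_self_nonneg hΓ (hvΓ k)
    simp only [mul_sub, Finset.sum_sub_distrib, ← Finset.sum_mul] at h1
    have : (∑ i, dlam f (v k) i) * t₀ = t₀ * T k := mul_comm _ _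
    linarith
  have hTpos : ∀ᶠ k in atTop, 0 < T k := by
    filter_upwards [hTlow] with k hk
    by_contra! h
    nlinarith
  -- The gradients may blow up at `∂Γ`. Divided by their trace, which is bounded below, they stay in
  -- a compact set; blow-up then appears as `α = 0`.
  set x : ℕ → (Fin n → ℝ) × ℝ := fun k => (fun i => dlam f (v k) i / T k, 1 / T k) with hx
  have hcomp : IsCompact (stdSimplex ℝ (Fin n) ×ˢ Icc (0 : ℝ) (2 * t₀ / c)) :=
    (isCompact_stdSimplex ℝ (Fin n)).prod isCompact_Icc
  have hmem : ∀ᶠ k in atTop, x k ∈ stdSimplex ℝ (Fin n) ×ˢ Icc (0 : ℝ) (2 * t₀ / c) := by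
    filter_upwards [hTlow, hTpos] with k h1 h2
    refine ⟨⟨fun i => div_nonneg (hf.deriv_nonneg _ (hvΓ k) i) h2.le, ?_⟩, by positivity, ?_⟩
    · simp only [hx, ← Finset.sum_div]
      exact div_self h2.ne'
    · simp only [hx]
      rw [div_le_div_iff₀ h2 hc]
      linarith
  obtain ⟨⟨F, α⟩, ⟨⟨hF0, hF1⟩, hα⟩, φ, hφ, hlim⟩ := hcomp.tendsto_subseq' hmem.frequently
  have hφt := hφ.tendsto_atTop
  have hvφ : ∀ i, Tendsto (fun k => v (φ k) i) atTop (𝓝 (v₀ i)) := fun i =>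
    (tendsto_pi_nhds.1 (hv.comp hφt)) i
  have hFφ : ∀ i, Tendsto (fun k => dlam f (v (φ k)) i / T (φ k)) atTop (𝓝 (F i)) := fun i =>
    (tendsto_pi_nhds.1 ((continuous_fst.tendsto _).comp hlim)) i
  have hαφ : Tendsto (fun k => 1 / T (φ k)) atTop (𝓝 α) := (continuous_snd.tendsto _).comp hlim
  have hTφ := hφt.eventually hTpos
  have hsum : Tendsto (fun k => ∑ i, dlam f (v (φ k)) i / T (φ k) * v (φ k) i) atTop
      (𝓝 (∑ i, F i * v₀ i)) := tendsto_finsetSum _ fun i _ => (hFφ i).mul (hvφ i)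
  have hsum_eq : ∀ k, ∑ i, dlam f (v (φ k)) i / T (φ k) * v (φ k) i =
      (∑ i, dlam f (v (φ k)) i * v (φ k) i) / T (φ k) := fun k => by
    rw [Finset.sum_div]; exact Finset.sum_congr rfl fun i _ => by ring
  refine ⟨F, α, hF0, hF1, hα.1, hα.2, fun j hj => ?_, ?_, ?_, fun w hw => ?_⟩
  · refine ge_of_tendsto (hFφ j) ?_
    filter_upwards [hTφ, (hvφ j).eventually_lt_const hj] with k hk hk'
    rw [le_div_iff₀ hk]
    exact (hδ _ (hvΓ _) j hk').le
  · refine ge_of_tendsto hsum ?_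
    filter_upwards [hTφ] with k hk
    rw [hsum_eq]
    exact div_nonneg (hf.sum_mul_self_nonneg hΓ (hvΓ _)) hk.le
  · have key : ∀ ε > 0, ∑ i, F i * v₀ i ≤ α * (s + ε - f₀) := fun ε hε => by
      refine le_of_tendsto_of_tendsto hsum (hαφ.mul_const (s + ε - f₀)) ?_
      filter_upwards [hTφ, hφt.eventually (hlt ε hε)] with k hk hk'
      rw [hsum_eq, one_div_mul_eq_div]
      have := hf.sum_mul_self_le hΓ hf₀ (hvΓ (φ k))
      exact div_le_div_of_nonneg_right (by linarith) hk.le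
    have hlim0 : Tendsto (fun ε : ℝ => α * (s + ε - f₀)) (𝓝[>] 0) (𝓝 (α * (s + 0 - f₀))) :=
      (Continuous.tendsto (by fun_prop) _).mono_left nhdsWithin_le_nhds
    rw [add_zero] at hlim0
    exact ge_of_tendsto hlim0 (eventually_mem_nhdsWithin.mono fun ε hε => key ε hε)
  · have key : ∀ ε > 0, α * (f w - (s + ε)) ≤ ∑ i, F i * (w i - v₀ i) := fun ε hε => by
      refine le_of_tendsto_of_tendsto (hαφ.mul_const (f w - (s + ε)))
        (tendsto_finsetSum _ fun i _ => (hFφ i).mul (tendsto_const_nhds.sub (hvφ i))) ?_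
      filter_upwards [hTφ, hφt.eventually (hlt ε hε)] with k hk hk'
      have h1 := hf.le_add_sum hΓ (hvΓ (φ k)) hw
      have h2 : ∑ i, dlam f (v (φ k)) i / T (φ k) * (w i - v (φ k) i) =
          (∑ i, dlam f (v (φ k)) i * (w i - v (φ k) i)) / T (φ k) := by
        rw [Finset.sum_div]; exact Finset.sum_congr rfl fun i _ => by ring
      rw [h2, one_div_mul_eq_div]
      exact div_le_div_of_nonneg_right (by linarith) hk.le
    have hlim0 : Tendsto (fun ε : ℝ => α * (f w - (s + ε))) (𝓝[>] 0) (𝓝 (α * (f w - (s + 0)))) :=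
      (Continuous.tendsto (by fun_prop) _).mono_left nhdsWithin_le_nhds
    rw [add_zero] at hlim0
    exact le_of_tendsto hlim0 (eventually_mem_nhdsWithin.mono fun ε hε => key ε hε)

/-- By Birkhoff's theorem `D` is an average of permutations, which preserve both `Γ` and `f`;
convexity and Jensen's inequality finish. -/
theorem IsCurvatureFunction.le_of_mem_doublyStochastic (hΓ : IsSymmCone Γ)
    (hf : IsCurvatureFunction Γ f) {D : Matrix (Fin n) (Fin n) ℝ}
    (hD : D ∈ doublyStochastic ℝ (Fin n)) {v : Fin n → ℝ} (hv : v ∈ Γ) :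
    D.mulVec v ∈ Γ ∧ f v ≤ f (D.mulVec v) := by
  obtain ⟨w, hw0, hw1, rfl⟩ := exists_eq_sum_perm_of_mem_doublyStochastic hD
  have h1 : (∑ σ, w σ • Equiv.Perm.permMatrix ℝ σ).mulVec v = ∑ σ, w σ • (v ∘ σ) := by
    rw [Matrix.sum_mulVec]
    refine Finset.sum_congr rfl fun σ _ => ?_
    rw [Matrix.smul_mulVec, Matrix.permMatrix_mulVec]
  rw [h1]
  refine ⟨hΓ.convex.sum_mem (fun σ _ => hw0 σ) hw1 fun σ _ => hΓ.symm v hv σ, ?_⟩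
  have := hf.concave.le_map_sum (t := Finset.univ) (w := w) (p := fun σ : Equiv.Perm (Fin n) => v ∘ σ)
    (fun σ _ => hw0 σ) hw1 fun σ _ => hΓ.symm v hv σ
  simpa [hf.symm v hv, ← Finset.sum_mul, hw1] using this

/-- The supporting inequality is extended to diagonals of matrices whose eigenvalues may lie on
`∂Γ`. -/
theorem mul_sub_le_of_doublyStochastic (hΓ : IsSymmCone Γ) (hf : IsCurvatureFunction Γ f)
    {F v₀ : Fin n → ℝ} {α s : ℝ} (hα : 0 ≤ α)
    (hF : ∀ w ∈ Γ, α * (f w - s) ≤ ∑ i, F i * (w i - v₀ i))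
    {D : Matrix (Fin n) (Fin n) ℝ} (hD : D ∈ doublyStochastic ℝ (Fin n))
    {v : Fin n → ℝ} {s' : ℝ} (hs' : extVal Γ f v = (s' : EReal)) :
    α * (s' - s) ≤ ∑ i, F i * (D.mulVec v i - v₀ i) := by
  have key : ∀ ε > 0, α * (s' - ε - s) ≤ ∑ i, F i * (D.mulVec v i - v₀ i) := by
    intro ε hε
    -- A limsup only provides points of `Γ` arbitrarily close to `v` with `f` almost `s'`; this is
    -- enough because the right-hand side is continuous.
    have hfreq : ∃ᶠ w in 𝓝[Γ] v, s' - ε < f w := by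
      intro h
      have h' := extVal_le (h.mono fun w hw => not_lt.1 hw)
      rw [hs', EReal.coe_le_coe_iff] at h'
      linarith
    have hc : Continuous fun w : Fin n → ℝ => ∑ i, F i * (D.mulVec w i - v₀ i) := by
      have : Continuous fun w : Fin n → ℝ => D.mulVec w := by fun_prop
      fun_prop
    refine ge_of_tendsto_of_frequently ((hc.tendsto v).mono_left nhdsWithin_le_nhds)
      ((hfreq.and_eventually self_mem_nhdsWithin).mono fun w hw => ?_)
    obtain ⟨h1, h2⟩ := hf.le_of_mem_doublyStochastic hΓ hD hw.2
    refine le_trans ?_ (hF _ h1)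
    exact mul_le_mul_of_nonneg_left (by linarith [hw.1]) hα
  have hlim0 : Tendsto (fun ε : ℝ => α * (s' - ε - s)) (𝓝[>] 0) (𝓝 (α * (s' - 0 - s))) :=
    (Continuous.tendsto (by fun_prop) _).mono_left nhdsWithin_le_nhds
  rw [sub_zero] at hlim0
  exact le_of_tendsto hlim0 (eventually_mem_nhdsWithin.mono fun ε hε => key ε hε)

end Curvature

/-! ### Diagonal entries of a symmetric matrix and its eigenvalues -/

section Form

variable {n : ℕ}

/-- The bilinear form of a matrix. -/
def form (A : Matrix (Fin n) (Fin n) ℝ) (y y' : EuclideanSpace ℝ (Fin n)) : ℝ :=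
  y.ofLp ⬝ᵥ A.mulVec y'.ofLp

theorem form_eigenvectorBasis {A : Matrix (Fin n) (Fin n) ℝ} (hA : A.IsHermitian)
    (y : EuclideanSpace ℝ (Fin n)) (j : Fin n) :
    form A y (hA.eigenvectorBasis j) = hA.eigenvalues j * inner ℝ y (hA.eigenvectorBasis j) := by
  rw [form, hA.mulVec_eigenvectorBasis, dotProduct_smul, smul_eq_mul,
    EuclideanSpace.inner_eq_star_dotProduct, star_trivial, dotProduct_comm]

theorem form_self_eq_sum {A : Matrix (Fin n) (Fin n) ℝ} (hA : A.IsHermitian)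
    (y : EuclideanSpace ℝ (Fin n)) :
    form A y y = ∑ j, inner ℝ y (hA.eigenvectorBasis j) ^ 2 * hA.eigenvalues j := by
  have h : ∀ y', form A y y' = ∑ j, inner ℝ (hA.eigenvectorBasis j) y' *
      form A y (hA.eigenvectorBasis j) := by
    intro y'
    conv_lhs => rw [← hA.eigenvectorBasis.sum_repr' y']
    simp only [form, WithLp.ofLp_sum, WithLp.ofLp_smul, Matrix.mulVec_sum, dotProduct_sum,
      Matrix.mulVec_smul, dotProduct_smul, smul_eq_mul]
  rw [h]
  refine Finset.sum_congr rfl fun j _ => ?_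
  rw [form_eigenvectorBasis, real_inner_comm]
  ring

theorem sq_inner_mem_doublyStochastic (b c : OrthonormalBasis (Fin n) ℝ (EuclideanSpace ℝ (Fin n))) :
    (Matrix.of fun i j => inner ℝ (b i) (c j) ^ 2) ∈ doublyStochastic ℝ (Fin n) := by
  rw [mem_doublyStochastic_iff_sum]
  refine ⟨fun i j => sq_nonneg _, fun i => ?_, fun j => ?_⟩
  · have := c.sum_sq_inner_left (b i)
    simpa using this
  · have := b.sum_sq_inner_right (c j)
    simpa using this

/-- The values on an orthonormal basis of the form of a symmetric matrix are obtained from its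
eigenvalues by a doubly stochastic matrix. -/
theorem exists_doublyStochastic_form {A : Matrix (Fin n) (Fin n) ℝ} (hA : A.IsHermitian)
    (b : OrthonormalBasis (Fin n) ℝ (EuclideanSpace ℝ (Fin n))) :
    ∃ D ∈ doublyStochastic ℝ (Fin n), ∀ i, form A (b i) (b i) = D.mulVec (eigs A) i := by
  refine ⟨_, sq_inner_mem_doublyStochastic b hA.eigenvectorBasis, fun i => ?_⟩
  rw [form_self_eq_sum hA, eigs, dif_pos hA]
  rfl

end Form

/-! ### The curvature matrix as a bilinear form -/

section Geometry

variable {n : ℕ}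

local notation "E" => EuclideanSpace ℝ (Fin n)

theorem inner_gradient_eq (u : E → ℝ) (x y : E) : inner ℝ (gradient u x) y = fderiv ℝ u x y := by
  rw [gradient, InnerProductSpace.toDual_symm_apply]

theorem gradient_apply (u : E → ℝ) (x : E) (i : Fin n) : gradient u x i = pd u x i := by
  rw [pd, ← inner_gradient_eq, EuclideanSpace.inner_single_right]
  simp

theorem wFac_sq (u : E → ℝ) (x : E) : wFac u x ^ 2 = 1 + ‖gradient u x‖ ^ 2 :=
  Real.sq_sqrt (by positivity)

theorem wFac_pos (u : E → ℝ) (x : E) : 0 < wFac u x := Real.sqrt_pos.2 (by positivity)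

/-- The action of the matrix `γ` on a vector. -/
def shear (u : E → ℝ) (x y : E) : E :=
  y - ((wFac u x * (wFac u x + 1))⁻¹ * inner ℝ (gradient u x) y) • gradient u x

theorem gam_mulVec (u : E → ℝ) (x y : E) : (gam u x).mulVec y.ofLp = (shear u x y).ofLp := by
  ext i
  simp only [Matrix.mulVec, dotProduct, gam, Matrix.of_apply, sub_mul, Finset.sum_sub_distrib,
    ite_mul, one_mul, zero_mul, Finset.sum_ite_eq, Finset.mem_univ, if_true, shear,
    PiLp.sub_apply, PiLp.smul_apply, smul_eq_mul, gradient_apply]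
  rw [PiLp.inner_apply, Finset.mul_sum, Finset.sum_mul]
  congr 1
  refine Finset.sum_congr rfl fun k _ => ?_
  simp only [gradient_apply, RCLike.inner_apply, conj_trivial]
  ring

theorem gam_isSymm (u : E → ℝ) (x : E) : (gam u x).transpose = gam u x := by
  ext i k
  simp only [gam, Matrix.transpose_apply, Matrix.of_apply, eq_comm (a := i) (b := k),
    mul_comm (pd u x i)]

theorem sum_pd2 (u : E → ℝ) (x a b : E) :
    ∑ k, ∑ l, a k * pd2 u x k l * b l = fderiv ℝ (fderiv ℝ u) x a b := by
  have h : ∀ y : E, y = ∑ k, y k • EuclideanSpace.single k (1 : ℝ) := fun y => by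
    ext i
    simp [Finset.sum_apply, Pi.single_apply]
  conv_rhs => rw [h a, h b]
  simp only [map_sum, map_smul, sum_apply, smul_apply,
    smul_eq_mul, pd2, Finset.mul_sum]
  rw [Finset.sum_comm]
  refine Finset.sum_congr rfl fun k _ => Finset.sum_congr rfl fun l _ => ?_
  ring

theorem form_curvatureMatrix_aux (u : E → ℝ) (x y y' : E) :
    form (curvatureMatrix u x) y y' = 1 / wFac u x *
      (inner ℝ (shear u x y) (shear u x y') +
        inner ℝ (gradient u x) (shear u x y) * inner ℝ (gradient u x) (shear u x y') +
        u x * fderiv ℝ (fderiv ℝ u) x (shear u x y) (shear u x y')) := by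
  set N : Matrix (Fin n) (Fin n) ℝ := Matrix.of fun k l =>
    ((if k = l then 1 else 0) + pd u x k * pd u x l + u x * pd2 u x k l) with hN
  have hA : curvatureMatrix u x = (1 / wFac u x) • (gam u x * N * gam u x) := by
    ext i j
    simp only [curvatureMatrix, Matrix.of_apply, Matrix.smul_apply, smul_eq_mul, Matrix.mul_apply,
      Finset.sum_mul, hN]
    rw [Finset.sum_comm]
  rw [form, hA, Matrix.smul_mulVec, dotProduct_smul, smul_eq_mul]
  congr 1
  rw [← Matrix.mulVec_mulVec, ← Matrix.mulVec_mulVec, Matrix.dotProduct_mulVec,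
    ← Matrix.mulVec_transpose, gam_isSymm, gam_mulVec, gam_mulVec, ← sum_pd2]
  simp only [dotProduct, Matrix.mulVec, hN, Matrix.of_apply, PiLp.inner_apply, RCLike.inner_apply,
    conj_trivial, gradient_apply, Finset.mul_sum, Finset.sum_mul, add_mul, mul_add,
    Finset.sum_add_distrib, ite_mul, one_mul, zero_mul, Finset.sum_ite_eq,
    Finset.mem_univ, if_true]
  congr 1
  · congr 1
    · exact Finset.sum_congr rfl fun k _ => by ring
    · rw [Finset.sum_comm]
      exact Finset.sum_congr rfl fun k _ => Finset.sum_congr rfl fun l _ => by ring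
  · exact Finset.sum_congr rfl fun k _ => Finset.sum_congr rfl fun l _ => by ring

theorem inner_gradient_shear (u : E → ℝ) (x y : E) :
    inner ℝ (gradient u x) (shear u x y) = inner ℝ (gradient u x) y / wFac u x := by
  have hw := wFac_pos u x
  have hw2 := wFac_sq u x
  rw [shear, inner_sub_right, inner_smul_right, real_inner_self_eq_norm_sq,
    show ‖gradient u x‖ ^ 2 = wFac u x ^ 2 - 1 by linarith]
  field_simp
  ring

/-- The matrix `γ` is the inverse square root of the metric `I + Du ⊗ Du`, so the first two terms
combine to the identity form. -/
theorem form_curvatureMatrix (u : E → ℝ) (x y y' : E) :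
    form (curvatureMatrix u x) y y' = 1 / wFac u x *
      (inner ℝ y y' + u x * fderiv ℝ (fderiv ℝ u) x (shear u x y) (shear u x y')) := by
  rw [form_curvatureMatrix_aux, inner_gradient_shear, inner_gradient_shear]
  congr 2
  have hw := wFac_pos u x
  have hw2 := wFac_sq u x
  simp only [shear, inner_sub_left, inner_sub_right, inner_smul_left, inner_smul_right,
    real_inner_self_eq_norm_sq, real_inner_comm (gradient u x) y, conj_trivial,
    show ‖gradient u x‖ ^ 2 = wFac u x ^ 2 - 1 by linarith]
  field_simp
  ring

theorem norm_shear_le (u : E → ℝ) (x y : E) : ‖shear u x y‖ ≤ ‖y‖ := by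
  have hw := wFac_pos u x
  have hw2 := wFac_sq u x
  have h : ‖shear u x y‖ ^ 2 = ‖y‖ ^ 2 - (inner ℝ (gradient u x) y / wFac u x) ^ 2 := by
    rw [← real_inner_self_eq_norm_sq, ← real_inner_self_eq_norm_sq]
    simp only [shear, inner_sub_left, inner_sub_right, inner_smul_left, inner_smul_right,
      real_inner_self_eq_norm_sq, real_inner_comm (gradient u x) y, conj_trivial,
      show ‖gradient u x‖ ^ 2 = wFac u x ^ 2 - 1 by linarith]
    field_simp
    ring
  refine abs_le_of_sq_le_sq' ?_ (norm_nonneg _) |>.2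
  rw [h]
  linarith [sq_nonneg (inner ℝ (gradient u x) y / wFac u x)]

end Geometry

/-! ### Derivatives along lines -/

section Lines

variable {V : Type*} [NormedAddCommGroup V] [NormedSpace ℝ V]

theorem hasDerivAt_apply_const {G G' : Type*} [NormedAddCommGroup G] [NormedSpace ℝ G]
    [NormedAddCommGroup G'] [NormedSpace ℝ G'] {c : ℝ → G →L[ℝ] G'} {c' : G →L[ℝ] G'} {t : ℝ}
    (hc : HasDerivAt c c' t) (y : G) : HasDerivAt (fun t => c t y) (c' y) t := by
  simpa using hc.clm_apply (hasDerivAt_const t y)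

theorem hasDerivAt_line (x z : V) (t : ℝ) : HasDerivAt (fun t : ℝ => x + t • z) z t := by
  simpa using ((hasDerivAt_id t).smul_const z).const_add x

theorem tendsto_line (x z : V) : Tendsto (fun t : ℝ => x + t • z) (𝓝 0) (𝓝 x) := by
  simpa using (hasDerivAt_line x z 0).continuousAt.tendsto

theorem hasDerivAt_comp_line {G : Type*} [NormedAddCommGroup G] [NormedSpace ℝ G] {f : V → G}
    {x z : V} {t : ℝ} (hf : DifferentiableAt ℝ f (x + t • z)) :
    HasDerivAt (fun t : ℝ => f (x + t • z)) (fderiv ℝ f (x + t • z) z) t :=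
  hf.hasFDerivAt.comp_hasDerivAt t (hasDerivAt_line x z t)

theorem hasJetAt_line {f : V → ℝ} {x : V} (hf : ContDiffAt ℝ 2 f x) (z : V) :
    HasJetAt (fun t : ℝ => f (x + t • z)) 0 (fderiv ℝ f x z) (fderiv ℝ (fderiv ℝ f) x z z) := by
  refine ⟨fun t => fderiv ℝ f (x + t • z) z, ?_, by simp, ?_⟩
  · have h := (hf.of_le (m := 1) (by norm_num)).eventually (by simp)
    filter_upwards [(tendsto_line x z).eventually h] with t ht
    exact hasDerivAt_comp_line (ht.differentiableAt one_ne_zero)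
  · have h : DifferentiableAt ℝ (fderiv ℝ f) (x + (0 : ℝ) • z) := by
      simpa using (hf.fderiv_right (m := 1) (by norm_num)).differentiableAt one_ne_zero
    have := hasDerivAt_apply_const (hasDerivAt_comp_line h) z
    rwa [zero_smul, add_zero] at this

theorem hasDerivAt_fderiv_fderiv_line {f : V → ℝ} {x : V} (hf : ContDiffAt ℝ 3 f x) (z : V) :
    HasDerivAt (fun t : ℝ => fderiv ℝ (fderiv ℝ f) (x + t • z))
      (fderiv ℝ (fderiv ℝ (fderiv ℝ f)) x z) 0 := by
  have hf1 : ContDiffAt ℝ 2 (fderiv ℝ f) x := hf.fderiv_right (by norm_num)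
  have hf2 : ContDiffAt ℝ 1 (fderiv ℝ (fderiv ℝ f)) x := hf1.fderiv_right (by norm_num)
  have h : DifferentiableAt ℝ (fderiv ℝ (fderiv ℝ f)) (x + (0 : ℝ) • z) := by
    simpa using hf2.differentiableAt one_ne_zero
  have := hasDerivAt_comp_line (G := V →L[ℝ] V →L[ℝ] ℝ) (f := fderiv ℝ (fderiv ℝ f)) h
  rwa [zero_smul, add_zero] at this

theorem hasJetAt_fderiv_line {f : V → ℝ} {x : V} (hf : ContDiffAt ℝ 3 f x) (z e : V) :
    HasJetAt (fun t : ℝ => fderiv ℝ f (x + t • z) e) 0 (fderiv ℝ (fderiv ℝ f) x z e)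
      (fderiv ℝ (fderiv ℝ (fderiv ℝ f)) x z z e) := by
  have hf1 : ContDiffAt ℝ 2 (fderiv ℝ f) x := hf.fderiv_right (by norm_num)
  refine ⟨fun t => fderiv ℝ (fderiv ℝ f) (x + t • z) z e, ?_, by simp, ?_⟩
  · have h := (hf1.of_le (m := 1) (by norm_num)).eventually (by simp)
    filter_upwards [(tendsto_line x z).eventually h] with t ht
    exact hasDerivAt_apply_const (hasDerivAt_comp_line (ht.differentiableAt one_ne_zero)) e
  · have h1 := hasDerivAt_apply_const (hasDerivAt_fderiv_fderiv_line hf z) z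
    exact hasDerivAt_apply_const h1 e

/-- Differentiating `u_e` twice along `z` and differentiating the equation along `e` produce the
third derivative with its arguments in different orders. Symmetry of the second derivative of `f`
near `x` exchanges the last two arguments, symmetry for `fderiv ℝ f` the first two. -/
theorem fderiv_fderiv_fderiv_comm {f : V → ℝ} {x : V} (hf : ContDiffAt ℝ 3 f x) (z e : V) :
    fderiv ℝ (fderiv ℝ (fderiv ℝ f)) x z z e = fderiv ℝ (fderiv ℝ (fderiv ℝ f)) x e z z := by
  have hf1 : ContDiffAt ℝ 2 (fderiv ℝ f) x := hf.fderiv_right (by norm_num)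
  have h := hasDerivAt_fderiv_fderiv_line hf z
  have hz := hasDerivAt_apply_const h z
  have he := hasDerivAt_apply_const h e
  have h1 := hasDerivAt_apply_const hz e
  have h2 := hasDerivAt_apply_const he z
  have h3 : (fun t : ℝ => fderiv ℝ (fderiv ℝ f) (x + t • z) z e) =ᶠ[𝓝 0]
      fun t : ℝ => fderiv ℝ (fderiv ℝ f) (x + t • z) e z := by
    filter_upwards [(tendsto_line x z).eventually (hf.eventually (by simp))] with t ht
    exact (ht.of_le (m := 2) (by norm_num)).isSymmSndFDerivAt (by simp) z e
  have hsymm := hf1.isSymmSndFDerivAt (by simp) z e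
  rw [(h1.congr_of_eventuallyEq h3.symm).unique h2, hsymm]

end Lines

section GradientLine

variable {n : ℕ}

local notation "E" => EuclideanSpace ℝ (Fin n)

theorem hasDerivAt_gradient_line {u : E → ℝ} {x : E} (hu : ContDiffAt ℝ 2 u x) (e : E) :
    HasDerivAt (fun t : ℝ => gradient u (x + t • e))
      ((InnerProductSpace.toDual ℝ E).symm (fderiv ℝ (fderiv ℝ u) x e)) 0 := by
  have h : DifferentiableAt ℝ (fderiv ℝ u) (x + (0 : ℝ) • e) := by
    simpa using (hu.fderiv_right (m := 1) (by norm_num)).differentiableAt one_ne_zero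
  have h1 := hasDerivAt_comp_line h
  have := ((InnerProductSpace.toDual ℝ E).symm.toContinuousLinearEquiv.toContinuousLinearMap
    |>.hasFDerivAt).comp_hasDerivAt (0 : ℝ) h1
  rw [zero_smul, add_zero] at this
  exact this

end GradientLine

theorem hasDerivAt_bilin_apply {V : Type*} [NormedAddCommGroup V] [NormedSpace ℝ V]
    {c : ℝ → V →L[ℝ] V →L[ℝ] ℝ} {c' : V →L[ℝ] V →L[ℝ] ℝ} {z : ℝ → V} {z' : V} {t : ℝ}
    (hc : HasDerivAt c c' t) (hz : HasDerivAt z z' t) :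
    HasDerivAt (fun t => c t (z t) (z t)) (c' (z t) (z t) + c t z' (z t) + c t (z t) z') t := by
  have h1 : HasDerivAt (fun t => c t (z t)) (c' (z t) + c t z') t := hc.clm_apply hz
  exact h1.clm_apply hz

/-! ### Derivatives of the curvature matrix and of the normal in the gradient direction -/

section LinearizedCurvature

variable {n : ℕ}

local notation "E" => EuclideanSpace ℝ (Fin n)

/-- The vector `g` with `D²u(e, ·) = p ⟨g, ·⟩`. -/
def logGrad (u : E → ℝ) (x e : E) (p : ℝ) : E :=
  p⁻¹ • (InnerProductSpace.toDual ℝ E).symm (fderiv ℝ (fderiv ℝ u) x e)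

theorem toDual_symm_eq_logGrad (u : E → ℝ) (x e : E) {p : ℝ} (hp : 0 < p) :
    (InnerProductSpace.toDual ℝ E).symm (fderiv ℝ (fderiv ℝ u) x e) = p • logGrad u x e p := by
  rw [logGrad, smul_smul, mul_inv_cancel₀ hp.ne', one_smul]

theorem fderiv_fderiv_eq_logGrad (u : E → ℝ) (x e y : E) {p : ℝ} (hp : 0 < p) :
    fderiv ℝ (fderiv ℝ u) x e y = p * inner ℝ (logGrad u x e p) y := by
  rw [← real_inner_smul_left, ← toDual_symm_eq_logGrad u x e hp,
    InnerProductSpace.toDual_symm_apply]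

theorem wFac_sq_of_gradient_eq {u : E → ℝ} {x e : E} {p : ℝ} (he : ‖e‖ = 1)
    (hq : gradient u x = p • e) : wFac u x ^ 2 = 1 + p ^ 2 := by
  rw [wFac_sq, hq, norm_smul, he, mul_one, Real.norm_eq_abs, sq_abs]

theorem shear_of_gradient_eq {u : E → ℝ} {x e : E} {p : ℝ} (he : ‖e‖ = 1)
    (hq : gradient u x = p • e) (y : E) :
    shear u x y = y - ((wFac u x - 1) / wFac u x * inner ℝ e y) • e := by
  have hw := wFac_pos u x
  have hw2 := wFac_sq_of_gradient_eq he hq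
  rw [shear, hq, real_inner_smul_left, smul_smul]
  congr 2
  field_simp
  linear_combination (-inner ℝ e y) * hw2

theorem hasDerivAt_wFac {u : E → ℝ} {x : E} (hu : ContDiffAt ℝ 2 u x) {p : ℝ} (hp : 0 < p)
    {e : E} (hq : gradient u x = p • e) :
    HasDerivAt (fun t : ℝ => wFac u (x + t • e))
      (p ^ 2 * inner ℝ e (logGrad u x e p) / wFac u x) 0 := by
  have h1 := hasDerivAt_gradient_line hu e
  rw [toDual_symm_eq_logGrad u x e hp] at h1
  have h2 := (h1.norm_sq.const_add 1).sqrt (by positivity)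
  simp only [zero_smul, add_zero] at h2
  have hw := wFac_pos u x
  have hww : √(1 + ‖gradient u x‖ ^ 2) = wFac u x := rfl
  rw [hww, hq, real_inner_smul_left, real_inner_smul_right] at h2
  refine h2.congr_deriv ?_
  field_simp

/-- Since `b` is an eigenvector of the curvature form, all second derivatives of `u` that arise from
differentiating `γ` can be expressed through `l` and inner products. What remains is the squared
term with coefficient `-2 u p³ / w³`, the source of the good term in `V i ^ 2`. -/
theorem hasDerivAt_form_curvatureMatrix {u : E → ℝ} {x : E} (hu : ContDiffAt ℝ 3 u x)
    (hux : 0 < u x) {p : ℝ} (hp : 0 < p) {e : E} (he : ‖e‖ = 1) (hq : gradient u x = p • e)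
    {b : E} (hb : ‖b‖ = 1) {l : ℝ}
    (hl : ∀ y, form (curvatureMatrix u x) y b = l * inner ℝ y b) :
    HasDerivAt (fun t : ℝ => form (curvatureMatrix u (x + t • e)) b b)
      (-(p ^ 2 * inner ℝ e (logGrad u x e p) / wFac u x ^ 2) * l +
        p / (u x * wFac u x) * (wFac u x * l - 1) +
        u x / wFac u x * fderiv ℝ (fderiv ℝ (fderiv ℝ u)) x e (shear u x b) (shear u x b) -
        2 * u x * (p ^ 3 / wFac u x ^ 3) * inner ℝ (logGrad u x e p) (shear u x b) ^ 2) 0 := by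
  have hu2 : ContDiffAt ℝ 2 u x := hu.of_le (by norm_num)
  have hw := wFac_pos u x
  have hw2 := wFac_sq_of_gradient_eq he hq
  have hee : inner ℝ e e = (1 : ℝ) := by rw [real_inner_self_eq_norm_sq, he, one_pow]
  have hU : HasDerivAt (fun t : ℝ => u (x + t • e)) p 0 := by
    have h : DifferentiableAt ℝ u (x + (0 : ℝ) • e) := by
      simpa using hu.differentiableAt (by norm_num)
    have := hasDerivAt_comp_line h
    rwa [zero_smul, add_zero, ← inner_gradient_eq, hq, real_inner_smul_left, hee, mul_one] at this
  have hG := hasDerivAt_gradient_line hu2 e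
  rw [toDual_symm_eq_logGrad u x e hp] at hG
  have hB := hasDerivAt_fderiv_fderiv_line hu e
  have hW := hasDerivAt_wFac hu2 hp hq
  have hform : ∀ y, u x * fderiv ℝ (fderiv ℝ u) x (shear u x y) (shear u x b) =
      (wFac u x * l - 1) * inner ℝ y b := by
    intro y
    have h := hl y
    rw [form_curvatureMatrix] at h
    field_simp at h
    linear_combination h
  set g := logGrad u x e p with hg
  set w := wFac u x with hwdef
  set z := shear u x b with hz
  set B := fderiv ℝ (fderiv ℝ u) x with hBdef
  have hBsymm : ∀ a c, B a c = B c a := fun a c => hu2.isSymmSndFDerivAt (by simp) a c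
  have hshe : shear u x e = w⁻¹ • e := by
    rw [shear_of_gradient_eq he hq, hee, mul_one, ← hwdef]
    nth_rewrite 1 [← one_smul ℝ e]
    rw [← sub_smul]
    congr 1
    field_simp
    ring
  -- The preimage of `g` under `γ`, needed because the eigenvector relation `hform` only evaluates
  -- the Hessian on sheared vectors.
  have hshg : shear u x (g + ((w - 1) * inner ℝ e g) • e) = g := by
    rw [shear_of_gradient_eq he hq, inner_add_right, real_inner_smul_right, hee, ← hwdef]
    have : (w - 1) / w * (inner ℝ e g + (w - 1) * inner ℝ e g * 1) = (w - 1) * inner ℝ e g := by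
      field_simp
      ring
    rw [this, add_sub_cancel_right]
  have hBe : B e z = p * inner ℝ g z := fderiv_fderiv_eq_logGrad u x e z hp
  have h1 : u x * (p * inner ℝ g z) = w * (w * l - 1) * inner ℝ e b := by
    have := hform e
    rw [hshe, map_smul, smul_apply, smul_eq_mul, hBe] at this
    field_simp at this
    linear_combination this
  have h2 : u x * B g z = (w * l - 1) * (inner ℝ g b + (w - 1) * inner ℝ e g * inner ℝ e b) := by
    have := hform (g + ((w - 1) * inner ℝ e g) • e)
    rwa [hshg, inner_add_left, real_inner_smul_left] at this
  have h3 : inner ℝ g z = inner ℝ g b - (w - 1) / w * inner ℝ e b * inner ℝ e g := by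
    rw [hz, shear_of_gradient_eq he hq, inner_sub_right, real_inner_smul_right,
      real_inner_comm e g]
  have hβ : HasDerivAt (fun t : ℝ => (wFac u (x + t • e) * (wFac u (x + t • e) + 1))⁻¹)
      (-(2 * w + 1) * (p ^ 2 * inner ℝ e g / w) / (w * (w + 1)) ^ 2) 0 := by
    have h := (hW.mul (hW.add_const 1)).inv (by
      have := wFac_pos u (x + (0 : ℝ) • e)
      simp only [Pi.mul_apply]
      positivity)
    refine h.congr_deriv ?_
    simp only [Pi.mul_apply, zero_smul, add_zero, ← hwdef]
    congr 1
    ring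
  have hZ : HasDerivAt (fun t : ℝ => shear u (x + t • e) b)
      (-((-(2 * w + 1) * (p ^ 2 * inner ℝ e g / w) / (w * (w + 1)) ^ 2 * (p * inner ℝ e b) +
        (w * (w + 1))⁻¹ * (p * inner ℝ g b)) * p) • e -
        ((w * (w + 1))⁻¹ * (p * inner ℝ e b) * p) • g) 0 := by
    have hi : HasDerivAt (fun t : ℝ => inner ℝ (gradient u (x + t • e)) b) (inner ℝ (p • g) b) 0 := by
      simpa using hG.inner ℝ (hasDerivAt_const (0 : ℝ) b)
    have h := ((hβ.mul hi).smul hG).const_sub b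
    refine h.congr_deriv ?_
    simp only [Pi.mul_apply, zero_smul, add_zero, ← hwdef, hq, real_inner_smul_left, smul_smul]
    module
  have hfun : (fun t : ℝ => form (curvatureMatrix u (x + t • e)) b b) = fun t : ℝ =>
      (1 + u (x + t • e) * fderiv ℝ (fderiv ℝ u) (x + t • e) (shear u (x + t • e) b)
        (shear u (x + t • e) b)) / wFac u (x + t • e) := by
    funext t
    rw [form_curvatureMatrix, real_inner_self_eq_norm_sq, hb]
    ring
  rw [hfun]
  have hmain := ((hU.mul (hasDerivAt_bilin_apply hB hZ)).const_add 1).div hW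
    (wFac_pos u _).ne'
  refine hmain.congr_deriv ?_
  simp only [Pi.mul_apply, zero_smul, add_zero, ← hwdef, ← hz, ← hBdef]
  have h4 : u x * B z z = w * l - 1 := by
    have := hform b
    rwa [real_inner_self_eq_norm_sq, hb, one_pow, mul_one] at this
  set D := fderiv ℝ (fderiv ℝ (fderiv ℝ u)) x e z z
  simp only [map_sub, map_smul, sub_apply, smul_apply, smul_eq_mul, hBsymm z e, hBsymm z g, hBe]
  -- One factor is expanded geometrically and the other by the eigenvector relation; the claim then
  -- becomes a rational identity modulo `p ^ 2 = w ^ 2 - 1`.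
  have hsq : inner ℝ g z ^ 2 = (inner ℝ g b - (w - 1) / w * inner ℝ e b * inner ℝ e g) *
      (w * (w * l - 1) * inner ℝ e b / (u x * p)) := by
    rw [sq]
    nth_rewrite 1 [h3]
    congr 1
    rw [eq_div_iff (by positivity)]
    linear_combination h1
  have hgz : inner ℝ g z = w * (w * l - 1) * inner ℝ e b / (u x * p) := by
    rw [eq_div_iff (by positivity)]
    linear_combination h1
  have hgg : B g z = (w * l - 1) * (inner ℝ g b + (w - 1) * inner ℝ e g * inner ℝ e b) / u x := by
    rw [eq_div_iff hux.ne']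
    linear_combination h2
  have hzz : B z z = (w * l - 1) / u x := by
    rw [eq_div_iff hux.ne']
    linear_combination h4
  rw [hsq, hgz, hgg, hzz]
  generalize inner ℝ g b = G
  generalize inner ℝ e g = g1
  generalize inner ℝ e b = ε
  have hp2 : p ^ 2 = w ^ 2 - 1 := by linarith
  have hw1 : w + 1 ≠ 0 := by positivity
  have hux' := hux.ne'
  have hw' := hw.ne'
  have hp' := hp.ne'
  generalize u x = U at *
  generalize w = W at *
  field_simp
  linear_combination (2 * U * p ^ 2 * (W * l - 1) * g1 * ε ^ 2 * (2 * W + 1)) * hp2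

/-- In fact the norm of the derivative equals `p / w` times that of `γ g`. Bounding by `γ g` rather
than `g` matters: `γ` shrinks the direction `e`, in which `g` has size of order `p`. -/
theorem exists_hasDerivAt_normal {u : E → ℝ} {x : E} (hu : ContDiffAt ℝ 2 u x)
    {p : ℝ} (hp : 0 < p) {e : E} (he : ‖e‖ = 1) (hq : gradient u x = p • e) :
    ∃ ν', HasDerivAt (fun t : ℝ => normal u (x + t • e)) ν' 0 ∧
      ‖ν'‖ ≤ ‖shear u x (logGrad u x e p)‖ := by
  have hw := wFac_pos u x
  have hw2 := wFac_sq_of_gradient_eq he hq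
  have hee : inner ℝ e e = (1 : ℝ) := by rw [real_inner_self_eq_norm_sq, he, one_pow]
  have hG := hasDerivAt_gradient_line hu e
  rw [toDual_symm_eq_logGrad u x e hp] at hG
  have hW := hasDerivAt_wFac hu hp hq
  have hwi := hW.inv (wFac_pos u _).ne'
  have hs := (hwi.smul hG).neg
  have hshg := shear_of_gradient_eq he hq (logGrad u x e p)
  simp only [zero_smul, add_zero, hq, smul_smul] at hwi hs
  set g := logGrad u x e p with hg
  set w := wFac u x with hwdef
  set k : ℝ := -(p ^ 2 * inner ℝ e g / w) / w ^ 2 with hk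
  set V : E := -((w⁻¹ * p) • g + (k * p) • e) with hV
  refine ⟨WithLp.toLp 2 (Fin.snoc (α := fun _ => ℝ) (fun i => V i) k), ?_, ?_⟩
  · have hpi : HasDerivAt (fun t : ℝ => Fin.snoc (α := fun _ => ℝ)
        (fun i => -pd u (x + t • e) i / wFac u (x + t • e)) (1 / wFac u (x + t • e)))
        (Fin.snoc (α := fun _ => ℝ) (fun i => V i) k) 0 := by
      rw [hasDerivAt_pi]
      refine Fin.lastCases ?_ fun i => ?_
      · simpa [Pi.inv_def] using hwi
      · have h := ((EuclideanSpace.proj i : E →L[ℝ] ℝ).hasFDerivAt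
          (x := _)).comp_hasDerivAt (0 : ℝ) hs
        simp only [Fin.snoc_castSucc]
        refine (h.congr_deriv ?_).congr_of_eventuallyEq (Eventually.of_forall fun t => ?_)
        · simp [hV, hwdef]
        · have hproj : ∀ v : E, (EuclideanSpace.proj i : E →L[ℝ] ℝ) v = v i := fun _ => rfl
          simp only [Function.comp, Pi.neg_apply, Pi.smul_apply', Pi.inv_apply, hproj,
            PiLp.neg_apply, PiLp.smul_apply, gradient_apply, smul_eq_mul]
          ring
    exact ((PiLp.continuousLinearEquiv 2 ℝ fun _ : Fin (n + 1) =>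
      ℝ).symm.toContinuousLinearMap.hasFDerivAt (x := _)).comp_hasDerivAt (0 : ℝ) hpi
  · refine abs_le_of_sq_le_sq' ?_ (norm_nonneg _) |>.2
    have h1 : ‖(WithLp.toLp 2 (Fin.snoc (α := fun _ => ℝ) (fun i => V i) k) :
        EuclideanSpace ℝ (Fin (n + 1)))‖ ^ 2 = ‖V‖ ^ 2 + k ^ 2 := by
      rw [EuclideanSpace.real_norm_sq_eq, EuclideanSpace.real_norm_sq_eq, Fin.sum_univ_castSucc]
      simp
    rw [h1, hshg, ← real_inner_self_eq_norm_sq, ← real_inner_self_eq_norm_sq, hV]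
    simp only [inner_neg_left, inner_neg_right, inner_add_left, inner_add_right, inner_sub_left,
      inner_sub_right, real_inner_smul_left, real_inner_smul_right, hee, real_inner_comm e g, hk]
    have hp2 : p ^ 2 = w ^ 2 - 1 := by linarith
    have hgg : inner ℝ e g ^ 2 ≤ inner ℝ g g := by
      have := real_inner_mul_inner_self_le e g
      rw [hee, one_mul] at this
      linarith
    generalize inner ℝ e g = g1 at *
    generalize inner ℝ g g = gg at *
    have hw' := hw.ne'
    have hsq : gg - (w - 1) / w * g1 * g1 - ((w - 1) / w * g1 * g1 - (w - 1) / w * g1 *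
        ((w - 1) / w * g1 * 1)) = gg - g1 ^ 2 + (g1 / w) ^ 2 := by
      field_simp
      ring
    have hL : p ^ 2 / w ^ 2 * (gg - g1 ^ 2 + (g1 / w) ^ 2) ≤ gg - g1 ^ 2 + (g1 / w) ^ 2 := by
      refine mul_le_of_le_one_left (by positivity) ?_
      rw [div_le_one (by positivity)]
      linarith
    refine le_trans (le_of_eq ?_) (hL.trans hsq.ge)
    field_simp
    linear_combination (g1 ^ 2 * (p ^ 2 - w ^ 2)) * hp2

end LinearizedCurvature

/-! ### The linearized equation -/

section Linearization

variable {n : ℕ}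

/-- `u` is an admissible solution of `f(λ(A)) = ψ(x, u, ν)` on the ball of radius `r`, with the
bounds `ψ ≤ S` and `|Dψ| ≤ K` along the solution. -/
structure IsSolution (Γ : Set (Fin n → ℝ)) (f : (Fin n → ℝ) → ℝ) (f₀ S K r : ℝ)
    (Ω : Set (EuclideanSpace ℝ (Fin n) × ℝ × EuclideanSpace ℝ (Fin (n + 1))))
    (ψ : EuclideanSpace ℝ (Fin n) × ℝ × EuclideanSpace ℝ (Fin (n + 1)) → ℝ) (u : EuclideanSpace ℝ (Fin n) → ℝ) : Prop where
  isOpen : IsOpen Ω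
  contDiffOn_rhs : ContDiffOn ℝ 1 ψ Ω
  deriv_height : ∀ p ∈ Ω, 0 < p.2.1 → 0 ≤ fderiv ℝ ψ p (0, 1, 0) - (ψ p - f₀) / p.2.1
  contDiffOn : ContDiffOn ℝ 3 u (Metric.ball 0 r)
  pos : ∀ x ∈ Metric.ball (0 : EuclideanSpace ℝ (Fin n)) r, 0 < u x
  jet_mem : ∀ x ∈ Metric.ball (0 : EuclideanSpace ℝ (Fin n)) r, jet u x ∈ Ω
  rhs_le : ∀ x ∈ Metric.ball (0 : EuclideanSpace ℝ (Fin n)) r, ψ (jet u x) ≤ S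
  norm_fderiv_le : ∀ x ∈ Metric.ball (0 : EuclideanSpace ℝ (Fin n)) r, ‖fderiv ℝ ψ (jet u x)‖ ≤ K
  curvatures_mem : ∀ x ∈ Metric.ball (0 : EuclideanSpace ℝ (Fin n)) r, curvatures u x ∈ closure Γ
  eqn : ∀ x ∈ Metric.ball (0 : EuclideanSpace ℝ (Fin n)) r,
    extVal Γ f (curvatures u x) = ((ψ (jet u x) : ℝ) : EReal)

variable {Γ : Set (Fin n → ℝ)} {f : (Fin n → ℝ) → ℝ} {f₀ S K r : ℝ}
  {Ω : Set (EuclideanSpace ℝ (Fin n) × ℝ × EuclideanSpace ℝ (Fin (n + 1)))}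
  {ψ : EuclideanSpace ℝ (Fin n) × ℝ × EuclideanSpace ℝ (Fin (n + 1)) → ℝ} {u : EuclideanSpace ℝ (Fin n) → ℝ}

theorem IsSolution.contDiffAt (H : IsSolution Γ f f₀ S K r Ω ψ u) {x : EuclideanSpace ℝ (Fin n)}
    (hx : x ∈ Metric.ball (0 : EuclideanSpace ℝ (Fin n)) r) : ContDiffAt ℝ 3 u x :=
  H.contDiffOn.contDiffAt (Metric.isOpen_ball.mem_nhds hx)

/-- Only the height component of the velocity of the jet carries the large factor `p`, and there the
structural condition on `ψ_u` applies; the other components cost at most `K`. -/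
theorem IsSolution.hasDerivAt_rhs (H : IsSolution Γ f f₀ S K r Ω ψ u) {x : EuclideanSpace ℝ (Fin n)}
    (hx : x ∈ Metric.ball (0 : EuclideanSpace ℝ (Fin n)) r) {p : ℝ} (hp : 0 < p) {e : EuclideanSpace ℝ (Fin n)} (he : ‖e‖ = 1)
    (hq : gradient u x = p • e) :
    ∃ a, HasDerivAt (fun t : ℝ => ψ (jet u (x + t • e))) a 0 ∧
      p * ((ψ (jet u x) - f₀) / u x) - K * (1 + ‖shear u x (logGrad u x e p)‖) ≤ a := by
  have hu := H.contDiffAt hx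
  have hu2 : ContDiffAt ℝ 2 u x := hu.of_le (by norm_num)
  obtain ⟨ν', hν, hνle⟩ := exists_hasDerivAt_normal hu2 hp he hq
  have hee : inner ℝ e e = (1 : ℝ) := by rw [real_inner_self_eq_norm_sq, he, one_pow]
  have hU : HasDerivAt (fun t : ℝ => u (x + t • e)) p 0 := by
    have h : DifferentiableAt ℝ u (x + (0 : ℝ) • e) := by
      simpa using hu.differentiableAt (by norm_num)
    have := hasDerivAt_comp_line h
    rwa [zero_smul, add_zero, ← inner_gradient_eq, hq, real_inner_smul_left, hee, mul_one] at this
  have hjet : HasDerivAt (fun t : ℝ => jet u (x + t • e)) (e, p, ν') 0 :=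
    (hasDerivAt_line x e 0).prodMk (hU.prodMk hν)
  have hψ : HasFDerivAt ψ (fderiv ℝ ψ (jet u x)) (jet u (x + (0 : ℝ) • e)) := by
    rw [zero_smul, add_zero]
    exact ((H.contDiffOn_rhs.contDiffAt (H.isOpen.mem_nhds (H.jet_mem x hx))).differentiableAt
      one_ne_zero).hasFDerivAt
  refine ⟨_, hψ.comp_hasDerivAt (0 : ℝ) hjet, ?_⟩
  have hsplit : ((e, p, ν') : EuclideanSpace ℝ (Fin n) × ℝ × EuclideanSpace ℝ (Fin (n + 1))) =
      p • ((0, 1, 0) : EuclideanSpace ℝ (Fin n) × ℝ × EuclideanSpace ℝ (Fin (n + 1))) + (e, 0, ν') := by simp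
  rw [hsplit, map_add, map_smul, smul_eq_mul]
  have h1 := H.deriv_height _ (H.jet_mem x hx) (H.pos x hx)
  have h1' : p * ((ψ (jet u x) - f₀) / u x) ≤ p * fderiv ℝ ψ (jet u x) (0, 1, 0) :=
    mul_le_mul_of_nonneg_left (sub_nonneg.1 h1) hp.le
  have hK := H.norm_fderiv_le x hx
  have h2 : |fderiv ℝ ψ (jet u x) (e, 0, ν')| ≤ K * (1 + ‖ν'‖) := by
    refine ((fderiv ℝ ψ (jet u x)).le_opNorm _).trans ?_
    refine mul_le_mul hK ?_ (norm_nonneg _) ((norm_nonneg _).trans hK)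
    rw [Prod.norm_mk, Prod.norm_mk, he, norm_zero]
    have := norm_nonneg ν'
    simp [this]
  have h3 : K * (1 + ‖ν'‖) ≤ K * (1 + ‖shear u x (logGrad u x e p)‖) :=
    mul_le_mul_of_nonneg_left (by linarith) ((norm_nonneg _).trans hK)
  linarith [neg_abs_le (fderiv ℝ ψ (jet u x) (e, 0, ν'))]

theorem IsSolution.exists_linearized (hΓ : IsSymmCone Γ) (hf : IsCurvatureFunction Γ f)
    (hf₀ : limsup (fun v => ((f v : ℝ) : EReal)) (𝓝[Γ] 0) = (f₀ : EReal))
    {c t₀ δ : ℝ} (hc : 0 < c) (ht : 0 < t₀) (hfc : S + c ≤ f fun _ => t₀)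
    (hδ : ∀ v ∈ Γ, ∀ j, v j < 0 → 2 * δ * ∑ i, dlam f v i < dlam f v j)
    (H : IsSolution Γ f f₀ S K r Ω ψ u) {x : EuclideanSpace ℝ (Fin n)}
    (hx : x ∈ Metric.ball (0 : EuclideanSpace ℝ (Fin n)) r) {p : ℝ} (hp : 0 < p) {e : EuclideanSpace ℝ (Fin n)} (he : ‖e‖ = 1)
    (hq : gradient u x = p • e) :
    ∃ (b : OrthonormalBasis (Fin n) ℝ (EuclideanSpace ℝ (Fin n))) (l F : Fin n → ℝ) (α : ℝ),
      (∀ i, 0 ≤ F i) ∧ ∑ i, F i = 1 ∧ 0 ≤ α ∧ α ≤ 2 * t₀ / c ∧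
      (∀ j, l j < 0 → 2 * δ ≤ F j) ∧ 0 ≤ ∑ i, F i * l i ∧ ∑ i, F i * l i ≤ α * (S - f₀) ∧
      (∀ i y, u x * fderiv ℝ (fderiv ℝ u) x (shear u x y) (shear u x (b i)) =
        (wFac u x * l i - 1) * inner ℝ y (b i)) ∧
      -(α * K * (1 + ‖shear u x (logGrad u x e p)‖)) +
        p ^ 2 * inner ℝ e (logGrad u x e p) / wFac u x ^ 2 * ∑ i, F i * l i +
        p / (u x * wFac u x) + 2 * u x * (p ^ 3 / wFac u x ^ 3) *
          ∑ i, F i * inner ℝ (logGrad u x e p) (shear u x (b i)) ^ 2 ≤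
      u x / wFac u x * ∑ i, F i *
        fderiv ℝ (fderiv ℝ (fderiv ℝ u)) x e (shear u x (b i)) (shear u x (b i)) := by
  have hu := H.contDiffAt hx
  have hux := H.pos x hx
  have hw := wFac_pos u x
  have hherm := fun {y : EuclideanSpace ℝ (Fin n)} (hy : y ∈ Metric.ball (0 : EuclideanSpace ℝ (Fin n)) r) =>
    curvatureMatrix_isHermitian ((H.contDiffAt hy).of_le (m := 2) (by norm_num))
  have hA := hherm hx
  have heig : curvatures u x = hA.eigenvalues := by rw [curvatures, eigs, dif_pos hA]
  obtain ⟨F, α, hF0, hF1, hα0, hα1, hneg, hs0, hs1, hsup⟩ :=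
    exists_normal hΓ hf hf₀ hc ht hfc hδ (H.curvatures_mem x hx) (H.eqn x hx) (H.rhs_le x hx)
  obtain ⟨a, ha, hale⟩ := H.hasDerivAt_rhs hx hp he hq
  set b := hA.eigenvectorBasis with hb
  set l := curvatures u x with hl
  have hform : ∀ i y, form (curvatureMatrix u x) y (b i) = l i * inner ℝ y (b i) := fun i y => by
    rw [form_eigenvectorBasis hA, heig]
  have hbn : ∀ i, ‖b i‖ = 1 := fun i => b.orthonormal.1 i
  have hD := fun i => hasDerivAt_form_curvatureMatrix hu hux hp he hq (hbn i) (hform i)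
  -- Supporting inequality plus majorisation: this function is nonnegative near `0` and vanishes at
  -- `0`. Its vanishing derivative is the linearized equation, obtained without differentiating `f`
  -- on `∂Γ`.
  have hmin : IsLocalMin (fun t : ℝ =>
      ∑ i, F i * (form (curvatureMatrix u (x + t • e)) (b i) (b i) - l i) -
        α * (ψ (jet u (x + t • e)) - ψ (jet u x))) 0 := by
    have h0 : ∀ i, form (curvatureMatrix u x) (b i) (b i) = l i := fun i => by
      rw [hform, real_inner_self_eq_norm_sq, hbn, one_pow, mul_one]
    filter_upwards [(tendsto_line x e).eventually (Metric.isOpen_ball.mem_nhds hx)] with t ht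
    simp only [zero_smul, add_zero, h0, sub_self, mul_zero, Finset.sum_const_zero]
    obtain ⟨D, hD, hDeq⟩ := exists_doublyStochastic_form (hherm ht) b
    have := mul_sub_le_of_doublyStochastic hΓ hf hα0 hsup hD (H.eqn _ ht)
    simp only [curvatures, ← hDeq] at this
    linarith
  have hder := (HasDerivAt.fun_sum fun i (_ : i ∈ Finset.univ) =>
    ((hD i).sub_const (l i)).const_mul (F i)).sub ((ha.sub_const (ψ (jet u x))).const_mul α)
  have hzero := hmin.hasDerivAt_eq_zero hder
  refine ⟨b, l, F, α, hF0, hF1, hα0, hα1, hneg, hs0, hs1.trans ?_, fun i y => ?_, ?_⟩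
  · exact mul_le_mul_of_nonneg_left (by linarith [H.rhs_le x hx]) hα0
  · have h := hform i y
    rw [form_curvatureMatrix] at h
    field_simp at h
    linear_combination h
  · have hexp : ∑ i, F i * (-(p ^ 2 * inner ℝ e (logGrad u x e p) / wFac u x ^ 2) * l i +
          p / (u x * wFac u x) * (wFac u x * l i - 1) +
          u x / wFac u x * fderiv ℝ (fderiv ℝ (fderiv ℝ u)) x e (shear u x (b i))
            (shear u x (b i)) -
          2 * u x * (p ^ 3 / wFac u x ^ 3) *
            inner ℝ (logGrad u x e p) (shear u x (b i)) ^ 2) =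
        -(p ^ 2 * inner ℝ e (logGrad u x e p) / wFac u x ^ 2) * ∑ i, F i * l i +
          p / u x * (∑ i, F i * l i) - p / (u x * wFac u x) * ∑ i, F i +
          u x / wFac u x * ∑ i, F i * fderiv ℝ (fderiv ℝ (fderiv ℝ u)) x e (shear u x (b i))
            (shear u x (b i)) -
          2 * u x * (p ^ 3 / wFac u x ^ 3) *
            ∑ i, F i * inner ℝ (logGrad u x e p) (shear u x (b i)) ^ 2 := by
      simp only [Finset.mul_sum, ← Finset.sum_add_distrib, ← Finset.sum_sub_distrib]
      refine Finset.sum_congr rfl fun i _ => ?_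
      field_simp
      ring
    rw [hexp, hF1] at hzero
    have h1 : α * (p * ((ψ (jet u x) - f₀) / u x) -
        K * (1 + ‖shear u x (logGrad u x e p)‖)) ≤ α * a := mul_le_mul_of_nonneg_left hale hα0
    -- The term of order `p / u` on the left of the equation is absorbed by the lower bound for
    -- `ψ_u`.
    have h2 : p / u x * (∑ i, F i * l i) ≤ p / u x * (α * (ψ (jet u x) - f₀)) :=
      mul_le_mul_of_nonneg_left hs1 (by positivity)
    have h3 : α * (p * ((ψ (jet u x) - f₀) / u x)) = p / u x * (α * (ψ (jet u x) - f₀)) := by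
      ring
    linarith

end Linearization

/-! ### First and second order conditions at a maximum -/

section MaximumPrinciple

variable {n : ℕ}

/-- The cutoff function `1 - |x|² / r²`. -/
def cutoff (r : ℝ) (x : EuclideanSpace ℝ (Fin n)) : ℝ := 1 - ‖x‖ ^ 2 / r ^ 2

theorem hasJetAt_cutoff_line (r : ℝ) (x z : EuclideanSpace ℝ (Fin n)) :
    HasJetAt (fun t : ℝ => cutoff r (x + t • z)) 0 (-(2 * inner ℝ x z) / r ^ 2)
      (-(2 * ‖z‖ ^ 2) / r ^ 2) := by
  have hfun : (fun t : ℝ => cutoff r (x + t • z)) = fun t : ℝ =>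
      1 - (‖x‖ ^ 2 + 2 * t * inner ℝ x z + t ^ 2 * ‖z‖ ^ 2) / r ^ 2 := by
    funext t
    rw [cutoff, norm_add_sq_real, norm_smul, real_inner_smul_right, mul_pow, Real.norm_eq_abs,
      sq_abs]
    ring
  rw [hfun]
  refine ⟨fun t => -(2 * inner ℝ x z + 2 * t * ‖z‖ ^ 2) / r ^ 2, Eventually.of_forall fun t => ?_,
    by simp, ?_⟩
  · have h1 := (((hasDerivAt_id t).const_mul 2).mul_const (inner ℝ x z)).const_add (‖x‖ ^ 2)
    have h2 := (h1.add (((hasDerivAt_id t).pow 2).mul_const (‖z‖ ^ 2))).div_const (r ^ 2)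
    refine (h2.const_sub 1).congr_deriv ?_
    simp
    ring
  · have h1 := ((((hasDerivAt_id (0 : ℝ)).const_mul 2).mul_const (‖z‖ ^ 2)).const_add
      (2 * inner ℝ x z)).neg.div_const (r ^ 2)
    refine h1.congr_deriv ?_
    simp

theorem cutoff_le_one (r : ℝ) (x : EuclideanSpace ℝ (Fin n)) : cutoff r x ≤ 1 := by
  rw [cutoff]
  have : 0 ≤ ‖x‖ ^ 2 / r ^ 2 := by positivity
  linarith

theorem norm_le_of_cutoff_pos {r : ℝ} (hr : 0 < r) {x : EuclideanSpace ℝ (Fin n)}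
    (hx : 0 < cutoff r x) : ‖x‖ < r := by
  rw [cutoff, sub_pos, div_lt_one (by positivity)] at hx
  exact lt_of_pow_lt_pow_left₀ 2 hr.le hx

/-- The first and second order conditions at an interior maximum of
`η² (φ(u) log u_e - θ)`, `η` the cutoff function. -/
theorem jet_of_isLocalMax {u : EuclideanSpace ℝ (Fin n) → ℝ} {x : EuclideanSpace ℝ (Fin n)}
    (hu : ContDiffAt ℝ 3 u x) {p : ℝ} (hp : 0 < p) {e : EuclideanSpace ℝ (Fin n)}
    (he : ‖e‖ = 1) (hq : gradient u x = p • e) {r : ℝ} (hr : 0 < r) (hη : 0 < cutoff r x)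
    {φ : ℝ → ℝ} {φ₁ φ₂ θ : ℝ} (hφ : HasJetAt φ (u x) φ₁ φ₂)
    (hZ : 0 < φ (u x) * Real.log p - θ)
    (hmax : IsLocalMax (fun y => cutoff r y ^ 2 * (φ (u y) * Real.log (fderiv ℝ u y e) - θ)) x)
    (z : EuclideanSpace ℝ (Fin n)) :
    φ (u x) * inner ℝ (logGrad u x e p) z =
        -((φ (u x) * Real.log p - θ) * (-(4 * inner ℝ x z) / (r ^ 2 * cutoff r x)) +
          φ₁ * Real.log p * (p * inner ℝ e z)) ∧
      (‖z‖ ≤ 1 → φ₂ * Real.log p * (p * inner ℝ e z) ^ 2 +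
        φ₁ * Real.log p * fderiv ℝ (fderiv ℝ u) x z z +
        2 * φ₁ * (p * inner ℝ e z) * inner ℝ (logGrad u x e p) z +
        φ (u x) * (fderiv ℝ (fderiv ℝ (fderiv ℝ u)) x e z z / p -
          inner ℝ (logGrad u x e p) z ^ 2) ≤
        28 * (φ (u x) * Real.log p - θ) / (r ^ 2 * cutoff r x ^ 2)) := by
  have hu2 : ContDiffAt ℝ 2 u x := hu.of_le (by norm_num)
  have hee : inner ℝ e e = (1 : ℝ) := by rw [real_inner_self_eq_norm_sq, he, one_pow]
  have hDu : ∀ y, fderiv ℝ u x y = p * inner ℝ e y := fun y => by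
    rw [← inner_gradient_eq, hq, real_inner_smul_left]
  have hDue : fderiv ℝ u x e = p := by rw [hDu, hee, mul_one]
  have hJρ := (hasJetAt_cutoff_line r x z).mul (hasJetAt_cutoff_line r x z)
  have hJu := hasJetAt_line hu2 z
  have hJφ : HasJetAt φ (u (x + (0 : ℝ) • z)) φ₁ φ₂ := by simpa using hφ
  have hJv := hasJetAt_fderiv_line hu z e
  have hJl : HasJetAt Real.log (fderiv ℝ u (x + (0 : ℝ) • z) e) p⁻¹ (-(p ^ 2)⁻¹) := by
    rw [zero_smul, add_zero, hDue]
    exact hasJetAt_log hp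
  have hJ := hJρ.mul (((hJφ.comp hJu).mul (hJl.comp hJv)).sub_const θ)
  have hmax' : IsLocalMax ((fun y => cutoff r y ^ 2 *
      (φ (u y) * Real.log (fderiv ℝ u y e) - θ)) ∘ fun t : ℝ => x + t • z) 0 :=
    IsMaxFilter.comp_tendsto (g := fun t : ℝ => x + t • z)
      (by rw [zero_smul, add_zero]; exact hmax)
      (tendsto_line x z)
  obtain ⟨hb, hc⟩ := hJ.of_isLocalMax (by simpa [Function.comp_def, sq] using hmax')
  have hsymm : fderiv ℝ (fderiv ℝ u) x z e = p * inner ℝ (logGrad u x e p) z := by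
    rw [hu2.isSymmSndFDerivAt (by simp) z e, fderiv_fderiv_eq_logGrad u x e z hp]
  simp only [zero_smul, add_zero, hDue, hDu, hsymm, fderiv_fderiv_fderiv_comm hu z e] at hb hc
  set η := cutoff r x with hηdef
  set Z := φ (u x) * Real.log p - θ with hZdef
  set G := inner ℝ (logGrad u x e p) z
  set X := inner ℝ x z
  set B := fderiv ℝ (fderiv ℝ u) x z z
  set D := fderiv ℝ (fderiv ℝ (fderiv ℝ u)) x e z z
  set a := inner ℝ e z
  set η' := -(2 * X) / r ^ 2 with hη'
  have hη1 : η ≤ 1 := cutoff_le_one r x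
  -- The first derivative of `φ(u) log u_e` is `-2 (η' / η) Z`; inserted in the mixed term of the
  -- second order condition it contributes `-8 η'² Z`.
  have hZ' : φ₁ * (p * a) * Real.log p + φ (u x) * (p⁻¹ * (p * G)) = -(2 * η' / η) * Z := by
    have : η * (η * (φ₁ * (p * a) * Real.log p + φ (u x) * (p⁻¹ * (p * G))) + 2 * η' * Z) = 0 := by
      linear_combination hb
    rcases mul_eq_zero.1 this with h | h
    · exact absurd h hη.ne'
    · field_simp
      field_simp at h
      linear_combination h
  rw [hZ'] at hc
  have hpG : p⁻¹ * (p * G) = G := by field_simp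
  rw [hpG] at hZ' hc
  refine ⟨?_, fun hz => ?_⟩
  · have : -(4 * X) / (r ^ 2 * η) = 2 * η' / η := by
      rw [hη']
      field_simp
      ring
    rw [this]
    linear_combination hZ'
  · have hX : X ^ 2 ≤ r ^ 2 := by
      have h1 := abs_real_inner_le_norm x z
      have h2 := (norm_le_of_cutoff_pos hr hη).le
      have h3 : |X| ≤ r := h1.trans (by nlinarith [norm_nonneg x, norm_nonneg z])
      exact sq_le_sq' (abs_le.1 h3).1 (abs_le.1 h3).2
    have hη'2 : η' ^ 2 ≤ 4 / r ^ 2 := by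
      rw [hη', div_pow, div_le_div_iff₀ (by positivity) (by positivity)]
      nlinarith [sq_nonneg r, mul_le_mul_of_nonneg_right hX (sq_nonneg r)]
    have hη'' : -2 / r ^ 2 ≤ -(2 * ‖z‖ ^ 2) / r ^ 2 := by
      refine div_le_div_of_nonneg_right ?_ (by positivity)
      nlinarith [norm_nonneg z]
    set η'' := -(2 * ‖z‖ ^ 2) / r ^ 2
    rw [le_div_iff₀ (by positivity)]
    set W := φ₂ * Real.log p * (p * a) ^ 2 + φ₁ * Real.log p * B + 2 * φ₁ * (p * a) * G +
      φ (u x) * (D / p - G ^ 2) with hW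
    have hc' : η ^ 2 * W ≤ (6 * η' ^ 2 - 2 * η * η'') * Z := by
      have h1 : (φ₂ * (p * a) ^ 2 + φ₁ * B) * Real.log p + 2 * (φ₁ * (p * a)) * G +
          φ (u x) * (-(p ^ 2)⁻¹ * (p * G) ^ 2 + p⁻¹ * D) = W := by
        rw [hW]
        field_simp
        ring
      rw [h1] at hc
      have h2 : 2 * (η' * η + η * η') * (-(2 * η' / η) * Z) = -8 * η' ^ 2 * Z := by
        field_simp
        ring
      rw [h2] at hc
      linarith
    -- The constant is `6 * 4 + 4`, from `η'² ≤ 4 / r²` and `-η'' ≤ 2 / r²` with `η ≤ 1`.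
    have h3 : 6 * η' ^ 2 - 2 * η * η'' ≤ 28 / r ^ 2 := by
      have : -(2 * η * η'') ≤ 4 / r ^ 2 := by
        have h4 : η * (-2 / r ^ 2) ≤ η * η'' := mul_le_mul_of_nonneg_left hη'' hη.le
        have h5 : η * (2 / r ^ 2) ≤ 1 * (2 / r ^ 2) :=
          mul_le_mul_of_nonneg_right hη1 (by positivity)
        have h6 : η * (-2 / r ^ 2) = -(η * (2 / r ^ 2)) := by ring
        have h7 : 4 / r ^ 2 = 2 * (1 * (2 / r ^ 2)) := by ring
        rw [h7]
        linarith
      have h8 : 28 / r ^ 2 = 6 * (4 / r ^ 2) + 4 / r ^ 2 := by ring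
      linarith
    have h4 := hc'.trans (mul_le_mul_of_nonneg_right h3 hZ.le)
    calc W * (r ^ 2 * η ^ 2) = r ^ 2 * (η ^ 2 * W) := by ring
      _ ≤ r ^ 2 * (28 / r ^ 2 * Z) := mul_le_mul_of_nonneg_left h4 (by positivity)
      _ = 28 * Z := by field_simp

end MaximumPrinciple

/-! ### The key inequality at the maximum point -/

section KeyInequality

variable {n : ℕ}

theorem inner_shear_comm (u : EuclideanSpace ℝ (Fin n) → ℝ) (x y y' : EuclideanSpace ℝ (Fin n)) :
    inner ℝ y (shear u x y') = inner ℝ (shear u x y) y' := by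
  simp only [shear, inner_sub_left, inner_sub_right, real_inner_smul_left, real_inner_smul_right,
    real_inner_comm (gradient u x) y]
  ring

theorem shear_smul_sub_smul (u : EuclideanSpace ℝ (Fin n) → ℝ)
    (x y y' : EuclideanSpace ℝ (Fin n)) (a c : ℝ) :
    shear u x (a • y - c • y') = a • shear u x y - c • shear u x y' := by
  simp only [shear, inner_sub_right, real_inner_smul_right, smul_sub, smul_smul]
  module

theorem shear_direction {u : EuclideanSpace ℝ (Fin n) → ℝ} {x e : EuclideanSpace ℝ (Fin n)} {p : ℝ}
    (he : ‖e‖ = 1) (hq : gradient u x = p • e) : shear u x e = (wFac u x)⁻¹ • e := by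
  have hw := wFac_pos u x
  rw [shear_of_gradient_eq he hq, real_inner_self_eq_norm_sq, he, one_pow, mul_one]
  nth_rewrite 1 [← one_smul ℝ e]
  rw [← sub_smul]
  congr 1
  field_simp
  ring

/-- If `k V i = (w l i - 1) ε i` with `∑ (ε i)² = 1` and `- k ∑ ε i V i ≥ 2`, then the indices with
`l i < 0` carry a fixed part of `∑ (V i)²`. -/
theorem sq_div_four_le_sum_neg {ι : Type*} [Fintype ι] {l ε V : ι → ℝ} {k w y : ℝ} (hk : 0 < k)
    (hw : 0 < w) (hrel : ∀ i, k * V i = (w * l i - 1) * ε i) (hε : ∑ i, ε i ^ 2 = 1)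
    (hy : ∑ i, ε i * V i = -y) (hky : 2 ≤ k * y) :
    y ^ 2 / 4 ≤ ∑ i with l i < 0, V i ^ 2 := by
  classical
  have h1 : k * y = ∑ i, (1 - w * l i) * ε i ^ 2 := by
    rw [show y = -∑ i, ε i * V i by linarith, mul_neg, Finset.mul_sum, ← Finset.sum_neg_distrib]
    exact Finset.sum_congr rfl fun i _ => by linear_combination (-ε i) * hrel i
  have h2 : ∑ i, (1 - w * l i) * ε i ^ 2 ≤
      ∑ i, ((if l i < 0 then k * (-(ε i * V i)) else 0) + ε i ^ 2) := by
    refine Finset.sum_le_sum fun i _ => ?_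
    split_ifs with h
    · have : k * (-(ε i * V i)) = (1 - w * l i) * ε i ^ 2 := by
        linear_combination (-ε i) * hrel i
      rw [this]
      linarith [sq_nonneg (ε i)]
    · have : 0 ≤ w * l i := mul_nonneg hw.le (not_lt.1 h)
      nlinarith [sq_nonneg (ε i)]
  rw [Finset.sum_add_distrib, hε, ← Finset.sum_filter, ← Finset.mul_sum] at h2
  set T := ∑ i with l i < 0, -(ε i * V i) with hT
  -- The indices with `l i ≥ 0` contribute at most `∑ ε i ^ 2 = 1` to `k * y ≥ 2`, so at least half
  -- comes from the negative ones.
  have hyT : y / 2 ≤ T := by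
    have : k * (y / 2) ≤ k * T := by linarith
    exact le_of_mul_le_mul_left this hk
  have hy0 : 0 < y := by
    by_contra! h
    nlinarith
  have h3 : T ^ 2 ≤ (∑ i with l i < 0, ε i ^ 2) * ∑ i with l i < 0, V i ^ 2 := by
    have := Finset.sum_mul_sq_le_sq_mul_sq (Finset.univ.filter fun i => l i < 0) ε V
    rwa [hT, Finset.sum_neg_distrib, neg_sq]
  have h4 : ∑ i with l i < 0, ε i ^ 2 ≤ 1 := by
    rw [← hε]
    exact Finset.sum_le_sum_of_subset_of_nonneg (Finset.filter_subset _ _) fun i _ _ => sq_nonneg _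
  have h5 : 0 ≤ ∑ i with l i < 0, V i ^ 2 := Finset.sum_nonneg fun i _ => sq_nonneg _
  have h6 : (y / 2) ^ 2 ≤ T ^ 2 := pow_le_pow_left₀ (by positivity) hyT 2
  nlinarith

/-- Elimination of the third derivatives between the linearized equation and the second order
condition. -/
theorem scalar_inequality {U p w L Λ ω κ α a K s ξ ξ₁ v Q τ SV SD : ℝ} (hU : 0 < U) (hp : 2 ≤ p)
    (hw : 0 < w) (hw2 : w ^ 2 = 1 + p ^ 2) (hL0 : 0 ≤ L) (hΛ0 : 0 ≤ Λ) (hω0 : 0 ≤ ω)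
    (hα0 : 0 ≤ α) (hα1 : α ≤ a) (hK : 0 ≤ K) (hξ0 : 0 ≤ ξ) (hξ₁ : |Λ * ξ₁| ≤ Λ * ξ)
    (hv0 : 0 ≤ v) (hv : v ≤ Λ * ξ + L * ω) (hs0 : 0 ≤ τ) (hs1 : τ ≤ α * s) (hSV0 : 0 ≤ SV)
    (hsum : SD / p ≤ Q + κ * L - ω * L * ((w * τ - 1) / U) + 4 * ω ^ 2 + 5 / 4 * SV)
    (hlin : -(α * K * (1 + v)) + p ^ 2 * (Λ * ξ₁ - ω * L * p) / w ^ 2 * τ +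
      p / (U * w) + 2 * U * (p ^ 3 / w ^ 3) * SV ≤ U / w * SD) :
    1 / U + U / 4 * SV ≤ U * Q + U * L * κ + L * ω + 4 * U * ω ^ 2 +
      a * (|s| + 2 * K) * (Λ * ξ + L * ω + 1) := by
  have hp0 : 0 < p := by linarith
  have hpw : p ≤ w := by nlinarith
  have ha : 0 ≤ a := hα0.trans hα1
  have hωL : 0 ≤ L * ω := mul_nonneg hL0 hω0
  have hΛξ : 0 ≤ Λ * ξ := mul_nonneg hΛ0 hξ0
  have hlin' := mul_le_mul_of_nonneg_left hlin (show 0 ≤ w / p by positivity)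
  have hsum' := mul_le_mul_of_nonneg_left hsum hU.le
  have e1 : w / p * (U / w * SD) = U * (SD / p) := by field_simp
  have e2 : w / p * (-(α * K * (1 + v)) + p ^ 2 * (Λ * ξ₁ - ω * L * p) / w ^ 2 * τ +
      p / (U * w) + 2 * U * (p ^ 3 / w ^ 3) * SV) =
      -(w / p * (α * K * (1 + v))) + p / w * (Λ * ξ₁ - ω * L * p) * τ +
      1 / U + 2 * U * (p ^ 2 / w ^ 2) * SV := by
    field_simp
  rw [e1, e2] at hlin'
  have hmain := hlin'.trans hsum'
  have hwp : w / p ≤ 2 := by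
    rw [div_le_iff₀ hp0]
    nlinarith
  have b1 : w / p * (α * K * (1 + v)) ≤
      2 * (a * K * (Λ * ξ + L * ω + 1)) := by
    have h1 : α * K * (1 + v) ≤ a * K * (Λ * ξ + L * ω + 1) :=
      mul_le_mul (mul_le_mul_of_nonneg_right hα1 hK) (by linarith) (by positivity) (by positivity)
    exact mul_le_mul hwp h1 (by positivity) (by norm_num)
  -- The good term then has coefficient at least `3 / 2`, against the loss `5 / 4` in `hsum`; the
  -- difference is the `1 / 4` in the conclusion.
  have b2 : 3 / 4 ≤ p ^ 2 / w ^ 2 := by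
    rw [hw2, div_le_div_iff₀ (by norm_num) (by positivity)]
    nlinarith
  have b3 : 3 / 2 * (U * SV) ≤ 2 * U * (p ^ 2 / w ^ 2) * SV := by
    have := mul_le_mul_of_nonneg_right b2 (mul_nonneg hU.le hSV0)
    linarith
  -- The two large terms `ω L p² / w` and `ω L w` nearly cancel and leave `-ω L / w`, because `w ^ 2
  -- = 1 + p ^ 2`.
  have b4 : -(p / w * (Λ * ξ₁ - ω * L * p) * τ) - ω * L * w * τ ≤ Λ * ξ * τ := by
    have h1 : -(p / w * (Λ * ξ₁ - ω * L * p)) - ω * L * w = p / w * (-(Λ * ξ₁)) - ω * L / w := by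
      field_simp
      linear_combination (-(ω * L)) * hw2
    have h2 : -(Λ * ξ₁) ≤ Λ * ξ := (neg_le_abs _).trans hξ₁
    have h3 : p / w * (-(Λ * ξ₁)) ≤ Λ * ξ := by
      have hpw1 : p / w ≤ 1 := (div_le_one hw).2 hpw
      calc p / w * (-(Λ * ξ₁)) ≤ p / w * (Λ * ξ) := mul_le_mul_of_nonneg_left h2 (by positivity)
        _ ≤ Λ * ξ := mul_le_of_le_one_left (by positivity) hpw1
    have h4 : 0 ≤ ω * L / w := by positivity
    have h5 : -(p / w * (Λ * ξ₁ - ω * L * p)) - ω * L * w ≤ Λ * ξ := by rw [h1]; linarith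
    have := mul_le_mul_of_nonneg_right h5 hs0
    linarith
  have b5 : Λ * ξ * τ ≤ a * |s| * (Λ * ξ + L * ω + 1) := by
    have h1 : τ ≤ a * |s| := by
      refine hs1.trans ((mul_le_mul_of_nonneg_left (le_abs_self _) hα0).trans ?_)
      exact mul_le_mul_of_nonneg_right hα1 (abs_nonneg _)
    calc Λ * ξ * τ ≤ Λ * ξ * (a * |s|) :=
          mul_le_mul_of_nonneg_left h1 (by positivity)
      _ = a * |s| * (Λ * ξ) := by ring
      _ ≤ _ := mul_le_mul_of_nonneg_left (by linarith) (by positivity)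
  have e3 : U * (Q + κ * L - ω * L * ((w * τ - 1) / U) + 4 * ω ^ 2 +
      5 / 4 * SV) = U * Q + U * L * κ - ω * L * w * τ + L * ω +
      4 * U * ω ^ 2 + 5 / 4 * (U * SV) := by
    field_simp
    ring
  rw [e3] at hmain
  linarith

/-- The weighted sum of the second order conditions, combined with the linearized equation. -/
theorem weighted_inequality {ι : Type*} [Fintype ι] {F l V ε D : ι → ℝ}
    {U p w L Λ ω κ α a K s ξ ξ₁ v Q : ℝ} (hU : 0 < U) (hp : 2 ≤ p) (hw : 0 < w)
    (hw2 : w ^ 2 = 1 + p ^ 2) (hL0 : 0 ≤ L) (hΛ0 : 0 ≤ Λ) (hω0 : 0 ≤ ω) (hκ0 : 0 ≤ κ)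
    (hα0 : 0 ≤ α) (hα1 : α ≤ a) (hK : 0 ≤ K) (hξ0 : 0 ≤ ξ) (hξ₁ : |Λ * ξ₁| ≤ Λ * ξ)
    (hv0 : 0 ≤ v) (hv : v ≤ Λ * ξ + L * ω)
    (hF0 : ∀ i, 0 ≤ F i) (hF1 : ∑ i, F i = 1) (hs0 : 0 ≤ ∑ i, F i * l i)
    (hs1 : ∑ i, F i * l i ≤ α * s) (hεle : ∀ i, ε i ^ 2 ≤ 1)
    (hsec : ∀ i, -κ * L * (p * (ε i / w)) ^ 2 + ω * L * ((w * l i - 1) / U) +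
      2 * ω * (p * (ε i / w)) * V i + (D i / p - V i ^ 2) ≤ Q)
    (hlin : -(α * K * (1 + v)) + p ^ 2 * (Λ * ξ₁ - ω * L * p) / w ^ 2 * ∑ i, F i * l i +
      p / (U * w) + 2 * U * (p ^ 3 / w ^ 3) * ∑ i, F i * V i ^ 2 ≤ U / w * ∑ i, F i * D i) :
    1 / U + U / 4 * ∑ i, F i * V i ^ 2 ≤ U * Q + U * L * κ + L * ω + 4 * U * ω ^ 2 +
      a * (|s| + 2 * K) * (Λ * ξ + L * ω + 1) := by
  have hp0 : 0 < p := by linarith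
  have hpw : p ≤ w := by nlinarith
  set τ := ∑ i, F i * l i with hτ
  set SV := ∑ i, F i * V i ^ 2 with hSV
  have hsecond : ∀ i, D i / p ≤ Q + κ * L - ω * L * ((w * l i - 1) / U) +
      4 * ω ^ 2 + 5 / 4 * V i ^ 2 := by
    intro i
    have h3 := hsec i
    have hpw1 : (p / w) ^ 2 ≤ 1 := by
      rw [div_pow, div_le_one (by positivity)]
      exact pow_le_pow_left₀ hp0.le hpw 2
    have hεw : (p * (ε i / w)) ^ 2 ≤ 1 := by
      have : (p * (ε i / w)) ^ 2 = (p / w) ^ 2 * ε i ^ 2 := by ring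
      rw [this]
      exact mul_le_one₀ hpw1 (sq_nonneg _) (hεle i)
    generalize p * (ε i / w) = a at *
    have h5 : κ * L * a ^ 2 ≤ κ * L := mul_le_of_le_one_right (mul_nonneg hκ0 hL0) hεw
    have h6 : ω ^ 2 * a ^ 2 ≤ ω ^ 2 := mul_le_of_le_one_right (sq_nonneg _) hεw
    -- Young's inequality on the mixed term costs `V i ^ 2 / 4`; with the `V i ^ 2` from
    -- differentiating the logarithm twice this makes `5 / 4`.
    linarith [sq_nonneg (2 * ω * a + V i / 2), show (2 * ω * a + V i / 2) ^ 2 =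
      4 * (ω ^ 2 * a ^ 2) + 2 * ω * a * V i + V i ^ 2 / 4 by ring]
  have hsum : (∑ i, F i * D i) / p ≤ Q + κ * L -
      ω * L * ((w * τ - 1) / U) + 4 * ω ^ 2 + 5 / 4 * SV := by
    have h1 : ∑ i, F i * (D i / p) ≤ ∑ i, F i * (Q + κ * L -
        ω * L * ((w * l i - 1) / U) + 4 * ω ^ 2 + 5 / 4 * V i ^ 2) :=
      Finset.sum_le_sum fun i _ => mul_le_mul_of_nonneg_left (hsecond i) (hF0 i)
    have h2 : ∑ i, F i * (Q + κ * L -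
        ω * L * ((w * l i - 1) / U) + 4 * ω ^ 2 + 5 / 4 * V i ^ 2) =
        (Q + κ * L + ω * L / U + 4 * ω ^ 2) * ∑ i, F i -
        ω * L * w / U * τ + 5 / 4 * SV := by
      simp only [hτ, hSV, Finset.mul_sum, ← Finset.sum_add_distrib, ← Finset.sum_sub_distrib]
      exact Finset.sum_congr rfl fun i _ => by ring
    have h3 : ∑ i, F i * (D i / p) = (∑ i, F i * D i) / p := by
      rw [Finset.sum_div]
      exact Finset.sum_congr rfl fun i _ => by ring
    rw [h3, h2, hF1] at h1
    refine h1.trans (le_of_eq ?_)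
    ring
  exact scalar_inequality hU hp hw hw2 hL0 hΛ0 hω0 hα0 hα1 hK hξ0 hξ₁ hv0 hv hs0 hs1
    (Finset.sum_nonneg fun i _ => mul_nonneg (hF0 i) (sq_nonneg _)) hsum hlin

variable {Γ : Set (Fin n → ℝ)} {f : (Fin n → ℝ) → ℝ} {f₀ S K r : ℝ}
  {Ω : Set (EuclideanSpace ℝ (Fin n) × ℝ × EuclideanSpace ℝ (Fin (n + 1)))}
  {ψ : EuclideanSpace ℝ (Fin n) × ℝ × EuclideanSpace ℝ (Fin (n + 1)) → ℝ}
  {u : EuclideanSpace ℝ (Fin n) → ℝ}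

set_option maxHeartbeats 1600000 in
/-- The inequality at an interior maximum of `η² (φ(u) log u_e - θ)`, with
`Λ = (φ(u) log u_e - θ) / φ(u)`. -/
theorem IsSolution.key_inequality (hΓ : IsSymmCone Γ) (hf : IsCurvatureFunction Γ f)
    (hf₀ : limsup (fun v => ((f v : ℝ) : EReal)) (𝓝[Γ] 0) = (f₀ : EReal))
    {c t₀ δ : ℝ} (hc : 0 < c) (ht : 0 < t₀) (hfc : S + c ≤ f fun _ => t₀) (hδ₀ : 0 < δ)
    (hδ : ∀ v ∈ Γ, ∀ j, v j < 0 → 2 * δ * ∑ i, dlam f v i < dlam f v j)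
    (H : IsSolution Γ f f₀ S K r Ω ψ u) {x : EuclideanSpace ℝ (Fin n)}
    (hx : x ∈ Metric.ball (0 : EuclideanSpace ℝ (Fin n)) r) {p : ℝ} (hp : 2 ≤ p)
    {e : EuclideanSpace ℝ (Fin n)} (he : ‖e‖ = 1) (hq : gradient u x = p • e)
    {R : ℝ} (hR : 0 < R) (hη : 0 < cutoff R x)
    {φ : ℝ → ℝ} {φ₁ φ₂ θ : ℝ} (hφ : HasJetAt φ (u x) φ₁ φ₂) (hφ0 : 0 < φ (u x))
    (hφ1 : 0 ≤ φ₁) (hφ2 : φ₂ ≤ 0) (hZ : 0 < φ (u x) * Real.log p - θ)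
    (hmax : IsLocalMax (fun y => cutoff R y ^ 2 * (φ (u y) * Real.log (fderiv ℝ u y e) - θ)) x)
    {Λ ω κ C₁ L : ℝ} (hΛ : Λ = (φ (u x) * Real.log p - θ) / φ (u x)) (hω : ω = φ₁ / φ (u x))
    (hκ : κ = -φ₂ / φ (u x)) (hC₁ : C₁ = 2 * t₀ / c * (|S - f₀| + 2 * K)) (hL : L = Real.log p) :
    ∃ SV y : ℝ, 0 ≤ SV ∧
      (p / wFac u x * (ω * L * p - Λ * (4 / (R * cutoff R x))) ≤ p * y) ∧
      (2 ≤ u x * p / wFac u x * y → δ * y ^ 2 / 2 ≤ SV) ∧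
      1 / u x + u x / 4 * SV ≤ 28 * u x * Λ / (R ^ 2 * cutoff R x ^ 2) + u x * L * κ + L * ω +
        4 * u x * ω ^ 2 + C₁ * (Λ * (4 / (R * cutoff R x)) + L * ω + 1) := by
  have hp0 : 0 < p := by linarith
  have hux := H.pos x hx
  have hw := wFac_pos u x
  have hw2 := wFac_sq_of_gradient_eq he hq
  have hpw : p ≤ wFac u x := by nlinarith
  obtain ⟨b, l, F, α, hF0, hF1, hα0, hα1, hneg, hs0, hs1, hform, hlin⟩ :=
    H.exists_linearized hΓ hf hf₀ hc ht hfc hδ hx hp0 he hq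
  have hjet := jet_of_isLocalMax (H.contDiffAt hx) hp0 he hq hR hη hφ hZ hmax
  have hK : 0 ≤ K := (norm_nonneg _).trans (H.norm_fderiv_le x hx)
  have hL0 : 0 ≤ L := hL ▸ Real.log_nonneg (by linarith)
  have hxR := norm_le_of_cutoff_pos hR hη
  rw [← hL] at hjet
  set g := logGrad u x e p with hg
  set w := wFac u x with hwdef
  set η := cutoff R x with hηdef
  set φ₀ := φ (u x) with hφ₀
  have hΛφ : φ₀ * L - θ = Λ * φ₀ := by rw [hΛ, hL]; field_simp
  have hφ1' : φ₁ = ω * φ₀ := by rw [hω]; field_simp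
  have hφ2' : φ₂ = -(κ * φ₀) := by rw [hκ]; field_simp
  have hΛ0 : 0 < Λ := by rw [hΛ]; positivity
  have hω0 : 0 ≤ ω := by rw [hω]; positivity
  have hκ0 : 0 ≤ κ := by rw [hκ]; exact div_nonneg (by linarith) hφ0.le
  rw [hΛφ, hφ1', hφ2'] at hjet
  clear_value φ₀ g w η
  set ξ : ℝ := 4 / (R * η) with hξ
  have hξ0 : 0 ≤ ξ := by positivity
  -- the first order condition
  have hgz : ∀ z, inner ℝ g z = Λ * (4 / (R ^ 2 * η)) * inner ℝ x z - ω * L * p * inner ℝ e z := by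
    intro z
    have := (hjet z).1
    have h2 : φ₀ * inner ℝ g z =
        φ₀ * (Λ * (4 / (R ^ 2 * η)) * inner ℝ x z - ω * L * p * inner ℝ e z) := by
      rw [this]; ring
    exact mul_left_cancel₀ hφ0.ne' h2
  have hee : inner ℝ e e = (1 : ℝ) := by rw [real_inner_self_eq_norm_sq, he, one_pow]
  -- The first order condition determines `D log u_e`: a cutoff error plus a multiple of `-e`
  -- produced by the weight.
  have hgvec : g = (Λ * (4 / (R ^ 2 * η))) • x - (ω * L * p) • e := by
    refine ext_inner_right ℝ fun z => ?_
    rw [hgz, inner_sub_left, real_inner_smul_left, real_inner_smul_left]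
  have hshe : shear u x e = w⁻¹ • e := by rw [shear_direction he hq, ← hwdef]
  have hcoef : Λ * (4 / (R ^ 2 * η)) * ‖x‖ ≤ Λ * ξ := by
    have : 4 / (R ^ 2 * η) * R = ξ := by rw [hξ]; field_simp
    rw [← this, ← mul_assoc]
    exact mul_le_mul_of_nonneg_left hxR.le (by positivity)
  have hshear_lin : shear u x g = (Λ * (4 / (R ^ 2 * η))) • shear u x x - (ω * L * p) • (w⁻¹ • e) := by
    rw [← hshe, hgvec, shear_smul_sub_smul]
  have hv : ‖shear u x g‖ ≤ Λ * ξ + L * ω := by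
    rw [hshear_lin]
    refine (norm_sub_le _ _).trans (add_le_add ?_ ?_)
    · rw [norm_smul, Real.norm_of_nonneg (by positivity)]
      exact (mul_le_mul_of_nonneg_left (norm_shear_le u x x) (by positivity)).trans hcoef
    · rw [norm_smul, norm_smul, he, Real.norm_of_nonneg (by positivity),
        Real.norm_of_nonneg (by positivity), mul_one]
      have : p * w⁻¹ ≤ 1 := by
        rw [← div_eq_mul_inv, div_le_one hw]; exact hpw
      nlinarith [mul_nonneg hω0 hL0]
  set ξ₁ : ℝ := 4 / (R ^ 2 * η) * inner ℝ x e with hξ₁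
  have hξ₁' : |Λ * ξ₁| ≤ Λ * ξ := by
    refine le_trans ?_ hcoef
    rw [hξ₁, ← mul_assoc, abs_mul, abs_of_nonneg (show 0 ≤ Λ * (4 / (R ^ 2 * η)) by positivity)]
    refine mul_le_mul_of_nonneg_left ?_ (by positivity)
    have := abs_real_inner_le_norm x e
    rwa [he, mul_one] at this
  have hg1 : inner ℝ e g = Λ * ξ₁ - ω * L * p := by
    rw [real_inner_comm, hgz, hee, hξ₁]; ring
  -- the sums
  set V : Fin n → ℝ := fun i => inner ℝ g (shear u x (b i)) with hV
  set ε : Fin n → ℝ := fun i => inner ℝ e (b i) with hε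
  have hεz : ∀ i, inner ℝ e (shear u x (b i)) = ε i / w := fun i => by
    rw [inner_shear_comm, hshe, real_inner_smul_left, hε]; ring
  have hε1 : ∑ i, ε i ^ 2 = 1 := by
    have := b.sum_sq_inner_left e
    rw [he, one_pow] at this
    exact this
  have hεle : ∀ i, ε i ^ 2 ≤ 1 := fun i => by
    rw [← hε1]
    exact Finset.single_le_sum (f := fun i => ε i ^ 2) (fun j _ => sq_nonneg _) (Finset.mem_univ i)
  -- The curvature form applied to `e` and `b i`; it ties the sign of `l i` to that of `ε i * V i`.
  have hrel : ∀ i, u x * p / w * V i = (w * l i - 1) * ε i := fun i => by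
    have := hform i e
    rw [hshe, map_smul, smul_apply, smul_eq_mul, fderiv_fderiv_eq_logGrad u x e _ hp0, ← hg] at this
    rw [hV, ← this]
    field_simp
  have hεV : ∑ i, ε i * V i = -(-(inner ℝ e g / w)) := by
    have h1 : ∀ i, ε i * V i = inner ℝ e (b i) * inner ℝ (b i) (shear u x g) := fun i => by
      rw [hV, hε]
      simp only
      rw [inner_shear_comm, real_inner_comm (b i) (shear u x g)]
    rw [Finset.sum_congr rfl fun i _ => h1 i, b.sum_inner_mul_inner, inner_shear_comm, hshe,
      real_inner_smul_left]
    ring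
  refine ⟨∑ i, F i * V i ^ 2, -(inner ℝ e g / w),
    Finset.sum_nonneg fun i _ => mul_nonneg (hF0 i) (sq_nonneg _), ?_, fun hX => ?_, ?_⟩
  · rw [hg1]
    have : p * -((Λ * ξ₁ - ω * L * p) / w) = p / w * (ω * L * p - Λ * ξ₁) := by ring
    rw [this]
    exact mul_le_mul_of_nonneg_left (by linarith [le_abs_self (Λ * ξ₁)]) (by positivity)
  · have h1 := sq_div_four_le_sum_neg (by positivity) hw hrel hε1 hεV hX
    -- Condition (iii) enters here: negative curvatures carry weight at least `2 * δ`.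
    have h2 : ∑ i with l i < 0, 2 * δ * V i ^ 2 ≤ ∑ i, F i * V i ^ 2 := by
      refine le_trans (Finset.sum_le_sum fun i hi => ?_) (Finset.sum_le_sum_of_subset_of_nonneg
        (Finset.filter_subset (fun i => l i < 0) _) fun i _ _ => mul_nonneg (hF0 i) (sq_nonneg _))
      exact mul_le_mul_of_nonneg_right (hneg i (Finset.mem_filter.1 hi).2) (sq_nonneg _)
    rw [← Finset.mul_sum] at h2
    nlinarith
  · set D : Fin n → ℝ := fun i =>
      fderiv ℝ (fderiv ℝ (fderiv ℝ u)) x e (shear u x (b i)) (shear u x (b i)) with hD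
    refine (weighted_inequality (D := D) (ε := ε) (V := V) (v := ‖shear u x g‖) hux hp hw hw2 hL0
      hΛ0.le hω0 hκ0 hα0 hα1 hK hξ0 hξ₁' (norm_nonneg _) hv hF0 hF1 hs0 hs1 hεle
      (Q := 28 * Λ / (R ^ 2 * η ^ 2)) (fun i => ?_) ?_).trans (le_of_eq ?_)
    · have hz1 : ‖shear u x (b i)‖ ≤ 1 := (norm_shear_le u x _).trans (b.orthonormal.1 i).le
      have h1 := (hjet (shear u x (b i))).2 hz1
      have h2 : fderiv ℝ (fderiv ℝ u) x (shear u x (b i)) (shear u x (b i)) =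
          (w * l i - 1) / u x := by
        rw [eq_div_iff hux.ne', mul_comm, hform, real_inner_self_eq_norm_sq, b.orthonormal.1 i,
          one_pow, mul_one]
      rw [h2, hεz] at h1
      have h4 : φ₀ * (-κ * L * (p * (ε i / w)) ^ 2 + ω * L * ((w * l i - 1) / u x) +
          2 * ω * (p * (ε i / w)) * V i + (D i / p - V i ^ 2)) ≤
          φ₀ * (28 * Λ / (R ^ 2 * η ^ 2)) := by
        refine le_trans (le_of_eq ?_) (h1.trans (le_of_eq ?_)) <;> ring
      exact le_of_mul_le_mul_left h4 hφ0
    · rw [← hg1]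
      exact hlin
    · rw [hC₁]
      ring

end KeyInequality

/-! ### Numerical contradictions in the two regimes -/

section Numeric

theorem threshold_bounds {M R η L N C₂ : ℝ} (hM : 0 < M) (hR : 0 < R) (hη : 0 < η) (hη1 : η ≤ 1)
    (hN : N = C₂ * (1 + M + M ^ 2 / R ^ 2)) (hC₂ : 1 ≤ C₂) (hL : N ≤ L * η ^ 2) :
    0 < L ∧ N ≤ L * η ∧ N ≤ L ∧ C₂ ≤ N ∧ C₂ * M ≤ N ∧ C₂ * M ^ 2 ≤ N * R ^ 2 ∧
      C₂ * M ≤ N * R := by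
  have hm : 0 ≤ M ^ 2 / R ^ 2 := by positivity
  have hN1 : C₂ ≤ N := by rw [hN]; nlinarith
  have hL0 : 0 < L := by
    by_contra! hneg
    nlinarith [mul_nonneg (neg_nonneg.2 hneg) (sq_nonneg η)]
  have hη2 : η ^ 2 ≤ η := by nlinarith
  have hLη : N ≤ L * η := hL.trans (mul_le_mul_of_nonneg_left hη2 hL0.le)
  refine ⟨hL0, hLη, hLη.trans (mul_le_of_le_one_right hL0.le hη1), hN1, ?_, ?_, ?_⟩
  · rw [hN]
    exact mul_le_mul_of_nonneg_left (by linarith) (by linarith)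
  · have : C₂ * M ^ 2 = C₂ * (M ^ 2 / R ^ 2) * R ^ 2 := by field_simp
    rw [this, hN]
    exact mul_le_mul_of_nonneg_right (mul_le_mul_of_nonneg_left (by linarith) (by linarith))
      (sq_nonneg R)
  · have h1 : M / R ≤ 1 + M + M ^ 2 / R ^ 2 := by
      rw [← div_pow]; nlinarith [sq_nonneg (M / R - 1)]
    have : C₂ * M = C₂ * (M / R) * R := by field_simp
    rw [this, hN]
    exact mul_le_mul_of_nonneg_right (mul_le_mul_of_nonneg_left h1 (by linarith)) hR.le

/-- Here `U ≤ θ² M / L²` is so small that, after multiplication by `U`, the good term is `1` while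
the errors add up to at most `33 / 100`. -/
theorem false_of_slow_regime {U M R η L θ C₁ N C₂ : ℝ} (hU : 0 < U) (hM : 0 < M) (hR : 0 < R)
    (hη : 0 < η) (hη1 : η ≤ 1) (hC₁ : 0 ≤ C₁) (hN : N = C₂ * (1 + M + M ^ 2 / R ^ 2))
    (hC₂ : 1 ≤ C₂) (hC₂θ : 100 * θ ^ 4 ≤ C₂) (hC₂C : 100 * C₁ * θ ^ 2 ≤ C₂)
    (hL : N ≤ L * η ^ 2) (hsw : U * L ^ 2 ≤ θ ^ 2 * M)
    (h : 1 / U ≤ 28 * U * L / (R ^ 2 * η ^ 2) + C₁ * (L * (4 / (R * η)) + 1)) : False := by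
  obtain ⟨hL0, hLη, hLN, hN1', hNM, hNR2, hNR⟩ := threshold_bounds hM hR hη hη1 hN hC₂ hL
  have hN1 : 1 ≤ N := hC₂.trans hN1'
  have hL1 : 1 ≤ L := hN1.trans hLN
  -- each term on the right, multiplied by `U`, is small
  have hA : 100 * (U ^ 2 * L) ≤ R ^ 2 * η ^ 2 := by
    have h1 : U ^ 2 * L ^ 4 ≤ θ ^ 4 * M ^ 2 := by
      have := mul_le_mul hsw hsw (by positivity) (by positivity)
      nlinarith
    have h2 : 100 * (U ^ 2 * L ^ 4) ≤ L * (η ^ 2 * R ^ 2) := by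
      calc 100 * (U ^ 2 * L ^ 4) ≤ 100 * (θ ^ 4 * M ^ 2) := by linarith
        _ = 100 * θ ^ 4 * M ^ 2 := by ring
        _ ≤ C₂ * M ^ 2 := mul_le_mul_of_nonneg_right hC₂θ (sq_nonneg M)
        _ ≤ N * R ^ 2 := hNR2
        _ ≤ L * η ^ 2 * R ^ 2 := mul_le_mul_of_nonneg_right hL (sq_nonneg R)
        _ = _ := by ring
    have h3 : 100 * (U ^ 2 * L ^ 3) ≤ η ^ 2 * R ^ 2 := by
      refine le_of_mul_le_mul_left ?_ hL0
      linarith [show L * (100 * (U ^ 2 * L ^ 3)) = 100 * (U ^ 2 * L ^ 4) by ring]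
    have h4 : U ^ 2 * L ≤ U ^ 2 * L ^ 3 :=
      mul_le_mul_of_nonneg_left (le_self_pow₀ hL1 (by norm_num)) (sq_nonneg U)
    linarith
  have hCU : 100 * (C₁ * (U * L ^ 2)) ≤ C₂ * M := by
    calc 100 * (C₁ * (U * L ^ 2)) ≤ 100 * (C₁ * (θ ^ 2 * M)) := by
          have := mul_le_mul_of_nonneg_left hsw hC₁
          linarith
      _ = 100 * C₁ * θ ^ 2 * M := by ring
      _ ≤ C₂ * M := mul_le_mul_of_nonneg_right hC₂C hM.le
  have hB : 100 * (C₁ * (U * L)) ≤ R * η := by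
    refine le_of_mul_le_mul_left ?_ hL0
    have := mul_le_mul_of_nonneg_right hLη hR.le
    linarith [show L * (100 * (C₁ * (U * L))) = 100 * (C₁ * (U * L ^ 2)) by ring,
      show L * (R * η) = L * η * R by ring]
  have hE : 100 * (C₁ * U) ≤ 1 := by
    have hL2 : N ≤ L ^ 2 := hLN.trans (le_self_pow₀ hL1 (by norm_num))
    have : L ^ 2 * (100 * (C₁ * U)) ≤ L ^ 2 * 1 := by
      linarith [show L ^ 2 * (100 * (C₁ * U)) = 100 * (C₁ * (U * L ^ 2)) by ring]
    exact le_of_mul_le_mul_left this (by positivity)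
  have hmul := mul_le_mul_of_nonneg_left h hU.le
  have e1 : U * (1 / U) = 1 := by field_simp
  have e2 : U * (28 * U * L / (R ^ 2 * η ^ 2) + C₁ * (L * (4 / (R * η)) + 1)) =
      28 * (U ^ 2 * L / (R ^ 2 * η ^ 2)) + 4 * (C₁ * (U * L) / (R * η)) + C₁ * U := by
    field_simp
    ring
  rw [e1, e2] at hmul
  have hA' : U ^ 2 * L / (R ^ 2 * η ^ 2) ≤ 1 / 100 := by
    rw [div_le_iff₀ (by positivity)]; linarith
  have hB' : C₁ * (U * L) / (R * η) ≤ 1 / 100 := by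
    rw [div_le_iff₀ (by positivity)]; linarith
  linarith

/-- The weight gives `U * ω ≥ σ / 4`, so `U * y` is at least `L * σ / 8`. This both reaches the
threshold in `hX` and makes the good term quadratic in `L * σ`. -/
theorem fast_regime_lower {U M R η L N C₂ δ σ p w ω Λ SV y : ℝ} (hU : 0 < U)
    (hM : 0 < M) (hR : 0 < R) (hη : 0 < η) (hη1 : η ≤ 1) (hδ : 0 < δ)
    (hN : N = C₂ * (1 + M + M ^ 2 / R ^ 2)) (hC₂ : 64 ≤ C₂) (hL : N ≤ L * η ^ 2) (hσ : 0 < σ)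
    (hσ1 : σ ≤ 1) (hσU : σ ^ 2 * M = U) (hsw : 20 ≤ L * σ)
    (hp0 : 0 < p) (hpL : L ≤ p) (hw : 0 < w) (hpw : 4 / 5 ≤ p / w) (hω0 : 0 < ω)
    (hUω1 : σ / 4 ≤ U * ω) (hΛ : Λ ≤ L) (hy : p / w * (ω * L * p - Λ * (4 / (R * η))) ≤ p * y)
    (hX : 2 ≤ U * p / w * y → δ * y ^ 2 / 2 ≤ SV) : δ * (L * σ) ^ 2 / 512 ≤ U ^ 2 * SV / 4 := by
  obtain ⟨hL0, hLη, hLN, hN1, hNM, hNR2, hNR⟩ :=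
    threshold_bounds hM hR hη hη1 hN (by linarith) hL
  have hξ0 : 0 < 4 / (R * η) := by positivity
  -- the first order condition is dominated by the height
  have hξp : 4 / (R * η) ≤ ω * p / 4 := by
    -- This is what `C₂ ≥ 64` is for: with `M * ω ≥ 1 / 4` it bounds the cutoff gradient by a
    -- quarter of `ω * p`.
    have h1 : 64 * M ≤ p * (R * η) := by
      calc 64 * M ≤ C₂ * M := mul_le_mul_of_nonneg_right hC₂ hM.le
        _ ≤ N * R := hNR
        _ ≤ L * η * R := mul_le_mul_of_nonneg_right hLη hR.le
        _ = L * (R * η) := by ring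
        _ ≤ p * (R * η) := mul_le_mul_of_nonneg_right hpL (by positivity)
    have h2 : 1 / 4 ≤ M * ω := by
      have : σ * (1 / 4) ≤ σ * (M * ω) := by
        calc σ * (1 / 4) = σ / 4 := by ring
          _ ≤ U * ω := hUω1
          _ = σ * (σ * (M * ω)) := by rw [← hσU]; ring
          _ ≤ σ * (M * ω) := mul_le_of_le_one_left (by positivity) hσ1
      exact le_of_mul_le_mul_left this hσ
    rw [div_le_iff₀ (by positivity)]
    have h3 := mul_le_mul_of_nonneg_left h1 hω0.le
    linarith [show ω * p / 4 * (R * η) = ω * (p * (R * η)) / 4 by ring,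
      show ω * (64 * M) = 64 * (M * ω) by ring]
  have hy' : ω * L / 2 ≤ y := by
    have h1 : Λ * (4 / (R * η)) ≤ L * (ω * p / 4) :=
      (mul_le_mul_of_nonneg_right hΛ hξ0.le).trans (mul_le_mul_of_nonneg_left hξp hL0.le)
    have h2 : p / w * (3 / 4 * (ω * L * p)) ≤ p * y :=
      (mul_le_mul_of_nonneg_left (by linarith) (by positivity)).trans hy
    have h3 : 4 / 5 * (3 / 4 * (ω * L * p)) ≤ p * y :=
      (mul_le_mul_of_nonneg_right hpw (by positivity)).trans h2
    refine le_of_mul_le_mul_left ?_ hp0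
    have : 0 ≤ ω * L * p := by positivity
    linarith [show p * (ω * L / 2) = ω * L * p / 2 by ring]
  have hLσ0 : 0 < L * σ := by positivity
  have hXge : 2 ≤ U * p / w * y := by
    have h1 : L * (σ / 4) ≤ L * (U * ω) := mul_le_mul_of_nonneg_left hUω1 hL0.le
    have h2 : U * (ω * L / 2) ≤ U * y := mul_le_mul_of_nonneg_left hy' hU.le
    have h3 : 4 / 5 * (U * y) ≤ p / w * (U * y) :=
      mul_le_mul_of_nonneg_right hpw (le_trans (by positivity) h2)
    linarith [show U * p / w * y = p / w * (U * y) by ring,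
      show L * (U * ω) = 2 * (U * (ω * L / 2)) by ring]
  have h1 : L * σ / 8 ≤ U * y := by
    have h2 : U * (ω * L / 2) ≤ U * y := mul_le_mul_of_nonneg_left hy' hU.le
    have h3 : L * (σ / 4) ≤ L * (U * ω) := mul_le_mul_of_nonneg_left hUω1 hL0.le
    linarith [show L * (U * ω) = 2 * (U * (ω * L / 2)) by ring]
  have h2 : (L * σ / 8) ^ 2 ≤ (U * y) ^ 2 := pow_le_pow_left₀ (by positivity) h1 2
  have h3 := mul_le_mul_of_nonneg_left (hX hXge) (sq_nonneg U)
  have h4 := mul_le_mul_of_nonneg_left h2 hδ.le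
  linarith [show δ * (L * σ / 8) ^ 2 = δ * (L * σ) ^ 2 / 64 by ring,
    show U ^ 2 * (δ * y ^ 2 / 2) = δ * (U * y) ^ 2 / 2 by ring]

/-- The good term is a multiple of `δ * (L * σ) ^ 2`. Errors linear in `L * σ` lose because `L * σ ≥
θ` with `θ * δ` large; all other errors are at most `(L * σ) ^ 2 / C₂` up to the factor `1 + C₁`. -/
theorem false_of_fast_regime {U M R η L θ C₁ N C₂ δ σ p w ω κ Λ SV y : ℝ} (hU : 0 < U)
    (hM : 0 < M) (hR : 0 < R) (hη : 0 < η) (hη1 : η ≤ 1) (hC₁ : 0 ≤ C₁) (hδ : 0 < δ)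
    (hN : N = C₂ * (1 + M + M ^ 2 / R ^ 2)) (hC₂ : 64 ≤ C₂)
    (hC₂δ : 100000 * (1 + C₁) ≤ C₂ * δ) (hθ : 20 ≤ θ) (hθδ : 2000 * (1 + C₁) ≤ θ * δ)
    (hL : N ≤ L * η ^ 2) (hσ : 0 < σ) (hσ1 : σ ≤ 1) (hσU : σ ^ 2 * M = U) (hsw : θ ≤ L * σ)
    (hp0 : 0 < p) (hpL : L ≤ p) (hw : 0 < w) (hpw : 4 / 5 ≤ p / w)
    (hω : ω = σ / (2 * U) / (1 + σ)) (hκ : κ = σ / (4 * U ^ 2) / (1 + σ)) (hΛ : Λ ≤ L)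
    (hSV : 0 ≤ SV) (hy : p / w * (ω * L * p - Λ * (4 / (R * η))) ≤ p * y)
    (hX : 2 ≤ U * p / w * y → δ * y ^ 2 / 2 ≤ SV)
    (h : 1 / U + U / 4 * SV ≤ 28 * U * Λ / (R ^ 2 * η ^ 2) + U * L * κ + L * ω +
        4 * U * ω ^ 2 + C₁ * (Λ * (4 / (R * η)) + L * ω + 1)) : False := by
  obtain ⟨hL0, hLη, hLN, hN1, hNM, hNR2, hNR⟩ :=
    threshold_bounds hM hR hη hη1 hN (by linarith) hL
  have hL1 : 1 ≤ L := by linarith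
  have hUM : U ≤ M := by
    rw [← hσU]; exact mul_le_of_le_one_left hM.le (pow_le_one₀ hσ.le hσ1)
  -- bounds for `U ω` and `U² κ`
  have hUω : U * ω = σ / (2 * (1 + σ)) := by rw [hω]; field_simp
  have hUω1 : σ / 4 ≤ U * ω := by
    rw [hUω, div_le_div_iff₀ (by norm_num) (by positivity)]
    exact mul_le_mul_of_nonneg_left (by linarith) hσ.le
  have hUω2 : U * ω ≤ σ / 2 := by
    rw [hUω, div_le_div_iff₀ (by positivity) (by norm_num)]
    exact mul_le_mul_of_nonneg_left (by linarith) hσ.le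
  have hUκ : U ^ 2 * κ ≤ σ / 4 := by
    have : U ^ 2 * κ = σ / (4 * (1 + σ)) := by rw [hκ]; field_simp
    rw [this, div_le_div_iff₀ (by positivity) (by norm_num)]
    exact mul_le_mul_of_nonneg_left (by linarith) hσ.le
  have hω0 : 0 < ω := by rw [hω]; positivity
  have hLσ0 : 0 < L * σ := by positivity
  have hUSV := fast_regime_lower hU hM hR hη hη1 hδ hN hC₂ hL hσ hσ1 hσU (hθ.trans hsw) hp0 hpL hw
    hpw hω0 hUω1 hΛ hy hX
  set P := (L * σ) ^ 2 with hP
  have hP0 : 0 < P := by positivity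
  have hLσP : θ * (L * σ) ≤ P := by
    rw [hP, sq]; exact mul_le_mul_of_nonneg_right hsw hLσ0.le
  -- the terms on the right, multiplied by `U`
  have hT1 : C₂ * (U ^ 2 * L / (R ^ 2 * η ^ 2)) ≤ P := by
    rw [← mul_div_assoc, div_le_iff₀ (by positivity)]
    calc C₂ * (U ^ 2 * L) = U * (C₂ * U) * L := by ring
      _ ≤ U * (C₂ * M) * L := by gcongr
      _ = σ ^ 2 * L * (C₂ * M ^ 2) := by rw [← hσU]; ring
      _ ≤ σ ^ 2 * L * (N * R ^ 2) := mul_le_mul_of_nonneg_left hNR2 (by positivity)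
      _ ≤ σ ^ 2 * L * (L * η ^ 2 * R ^ 2) := by gcongr
      _ = P * (R ^ 2 * η ^ 2) := by rw [hP]; ring
  have hT2 : C₂ * (U * L / (R * η)) ≤ P := by
    rw [← mul_div_assoc, div_le_iff₀ (by positivity)]
    calc C₂ * (U * L) = σ ^ 2 * L * (C₂ * M) := by rw [← hσU]; ring
      _ ≤ σ ^ 2 * L * (N * R) := mul_le_mul_of_nonneg_left hNR (by positivity)
      _ ≤ σ ^ 2 * L * (L * η * R) := by gcongr
      _ = P * (R * η) := by rw [hP]; ring
  have hL2 : N ≤ L ^ 2 := hLN.trans (le_self_pow₀ hL1 (by norm_num))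
  have hT3 : C₂ * U ≤ P := by
    calc C₂ * U = σ ^ 2 * (C₂ * M) := by rw [← hσU]; ring
      _ ≤ σ ^ 2 * L ^ 2 := mul_le_mul_of_nonneg_left (hNM.trans hL2) (by positivity)
      _ = P := by rw [hP]; ring
  have hT4 : C₂ * σ ^ 2 ≤ P := by
    calc C₂ * σ ^ 2 = σ ^ 2 * C₂ := by ring
      _ ≤ σ ^ 2 * L ^ 2 := mul_le_mul_of_nonneg_left (hN1.trans hL2) (by positivity)
      _ = P := by rw [hP]; ring
  have hmul := mul_le_mul_of_nonneg_left h hU.le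
  have e1 : U * (1 / U + U / 4 * SV) = 1 + U ^ 2 * SV / 4 := by field_simp
  have e2 : U * (28 * U * Λ / (R ^ 2 * η ^ 2) + U * L * κ + L * ω + 4 * U * ω ^ 2 +
      C₁ * (Λ * (4 / (R * η)) + L * ω + 1)) =
      28 * (U ^ 2 * Λ / (R ^ 2 * η ^ 2)) + L * (U ^ 2 * κ) + L * (U * ω) + 4 * (U * ω) ^ 2 +
      C₁ * (4 * (U * Λ / (R * η)) + L * (U * ω) + U) := by
    field_simp
  rw [e1, e2] at hmul
  have f1 : U ^ 2 * Λ / (R ^ 2 * η ^ 2) ≤ U ^ 2 * L / (R ^ 2 * η ^ 2) := by gcongr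
  have f2 : U * Λ / (R * η) ≤ U * L / (R * η) := by gcongr
  have f3 : L * (U ^ 2 * κ) ≤ L * (σ / 4) := mul_le_mul_of_nonneg_left hUκ hL0.le
  have f4 : L * (U * ω) ≤ L * (σ / 2) := mul_le_mul_of_nonneg_left hUω2 hL0.le
  have f5 : (U * ω) ^ 2 ≤ (σ / 2) ^ 2 := pow_le_pow_left₀ (by positivity) hUω2 2
  have f6 : C₁ * (4 * (U * Λ / (R * η)) + L * (U * ω) + U) ≤
      C₁ * (4 * (U * L / (R * η)) + L * (σ / 2) + U) :=
    mul_le_mul_of_nonneg_left (by linarith) hC₁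
  have hbound : 1 + δ * P / 512 ≤ 28 * (U ^ 2 * L / (R ^ 2 * η ^ 2)) + (1 + C₁) * (L * σ) +
      σ ^ 2 + C₁ * (4 * (U * L / (R * η)) + U) := by
    have : 0 ≤ C₁ * (L * σ) := by positivity
    linarith
  -- absorb
  have g1 : 2000 * ((1 + C₁) * (L * σ)) ≤ δ * P := by
    have h1 := mul_le_mul_of_nonneg_right hθδ hLσ0.le
    have h2 := mul_le_mul_of_nonneg_left hLσP hδ.le
    linarith
  have absorb : ∀ T, 0 ≤ T → C₂ * T ≤ P → 100000 * ((1 + C₁) * T) ≤ δ * P := fun T hT0 hT => by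
    have h1 := mul_le_mul_of_nonneg_right hC₂δ hT0
    have h2 := mul_le_mul_of_nonneg_left hT hδ.le
    linarith
  have a1 := absorb _ (by positivity) hT1
  have a2 := absorb _ (by positivity) hT2
  have a3 := absorb _ hU.le hT3
  have a4 := absorb _ (sq_nonneg σ) hT4
  have n1 : 0 ≤ C₁ * (U ^ 2 * L / (R ^ 2 * η ^ 2)) := by positivity
  have n2 : 0 ≤ U * L / (R * η) := by positivity
  have n4 : 0 ≤ C₁ * σ ^ 2 := by positivity
  have n5 : 0 < δ * P := by positivity
  linarith

end Numeric

/-! ### The weight -/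

section Main

/-- The square root is scale-adapted: `s φ'` and `s² φ''` are both of size `√(s / M)`, so in the
fast regime its errors are linear in `L * σ` against a quadratic gain. -/
theorem hasJetAt_one_add_sqrt {M s : ℝ} (hM : 0 < M) (hs : 0 < s) :
    HasJetAt (fun t => 1 + √(t / M)) s (√(s / M) / (2 * s)) (-(√(s / M) / (4 * s ^ 2))) := by
  have hd : ∀ t, 0 < t → HasDerivAt (fun t => √(t / M)) (√(t / M) / (2 * t)) t := fun t ht => by
    have h := ((hasDerivAt_id t).div_const M).sqrt (by simp only [id]; positivity)
    refine h.congr_deriv ?_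
    have h1 : √(t / M) ≠ 0 := (Real.sqrt_pos.2 (by positivity)).ne'
    simp only [id]
    rw [div_eq_div_iff (by positivity) (by positivity)]
    have h2 : √(t / M) * √(t / M) = t / M := Real.mul_self_sqrt (by positivity)
    linear_combination (-2) * h2
  refine ⟨fun t => √(t / M) / (2 * t), ?_, rfl, ?_⟩
  · filter_upwards [lt_mem_nhds hs] with t ht using (hd t ht).const_add 1
  · have h := (hd s hs).div ((hasDerivAt_id s).const_mul 2) (by simp only [id]; positivity)
    refine h.congr_deriv ?_
    simp only [id]
    field_simp
    ring

end Main

/-! ### The maximum point and the choice of regime -/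

section GradientBound

variable {n : ℕ} {Γ : Set (Fin n → ℝ)} {f : (Fin n → ℝ) → ℝ} {f₀ S K r : ℝ}
  {Ω : Set (EuclideanSpace ℝ (Fin n) × ℝ × EuclideanSpace ℝ (Fin (n + 1)))}
  {ψ : EuclideanSpace ℝ (Fin n) × ℝ × EuclideanSpace ℝ (Fin (n + 1)) → ℝ}
  {u : EuclideanSpace ℝ (Fin n) → ℝ}

theorem IsSolution.continuousOn_gradient (H : IsSolution Γ f f₀ S K r Ω ψ u) :
    ContinuousOn (gradient u) (Metric.ball 0 r) :=
  (InnerProductSpace.toDual ℝ (EuclideanSpace ℝ (Fin n))).symm.continuous.comp_continuousOn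
    (H.contDiffOn.continuousOn_fderiv_of_isOpen Metric.isOpen_ball (by norm_num))

theorem continuous_cutoff (R : ℝ) : Continuous (cutoff (n := n) R) := by
  unfold cutoff
  fun_prop

/-- A maximum of `η² (φ(u) log max(1, |Du|) - θ)` is a local maximum of the function with
`log u_e`, `e` the direction of `Du` at the point. -/
theorem isLocalMax_of_le {Q : EuclideanSpace ℝ (Fin n) → ℝ} {R θ : ℝ} {φ : ℝ → ℝ}
    {x e : EuclideanSpace ℝ (Fin n)} (hu : ContDiffAt ℝ 3 u x) (hux : 0 < u x)
    (he : ‖e‖ = 1) {p : ℝ} (hp : 1 ≤ p) (hq : gradient u x = p • e) (hφ : ∀ s, 0 < s → 0 ≤ φ s)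
    (hmax : IsLocalMax Q x)
    (hle : ∀ y, cutoff R y ^ 2 * (φ (u y) * Real.log (max 1 ‖gradient u y‖) - θ) ≤ Q y)
    (heq : cutoff R x ^ 2 * (φ (u x) * Real.log p - θ) = Q x) :
    IsLocalMax (fun y => cutoff R y ^ 2 * (φ (u y) * Real.log (fderiv ℝ u y e) - θ)) x := by
  have hDue : fderiv ℝ u x e = p := by
    rw [← inner_gradient_eq, hq, real_inner_smul_left, real_inner_self_eq_norm_sq, he, one_pow,
      mul_one]
  have hc : ContinuousAt (fun y => fderiv ℝ u y e) x :=
    ((hu.fderiv_right (m := 2) (by norm_num)).continuousAt).clm_apply continuousAt_const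
  have hpos : ∀ᶠ y in 𝓝 x, 0 < fderiv ℝ u y e :=
    hc.eventually (lt_mem_nhds (by show 0 < fderiv ℝ u x e; rw [hDue]; linarith))
  have hupos : ∀ᶠ y in 𝓝 x, 0 < u y := hu.continuousAt.eventually (lt_mem_nhds hux)
  filter_upwards [hmax, hpos, hupos] with y h1 h2 h3
  rw [hDue, heq]
  refine le_trans ?_ ((hle y).trans h1)
  have h4 : fderiv ℝ u y e ≤ max 1 ‖gradient u y‖ := by
    rw [← inner_gradient_eq]
    refine (real_inner_le_norm _ _).trans ?_
    rw [he, mul_one]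
    exact le_max_right _ _
  have h5 := mul_le_mul_of_nonneg_left (Real.log_le_log h2 h4) (hφ _ h3)
  exact mul_le_mul_of_nonneg_left (by linarith) (sq_nonneg _)

-- If the bound fails at the centre, where the cutoff is `1`, the test function is at least `2 * N`
-- there, so its maximum is interior and has `L * η² ≥ N`. Either regime then gives a contradiction.
set_option maxHeartbeats 1000000 in
theorem IsSolution.log_gradient_lt (hΓ : IsSymmCone Γ) (hf : IsCurvatureFunction Γ f)
    (hf₀ : limsup (fun v => ((f v : ℝ) : EReal)) (𝓝[Γ] 0) = (f₀ : EReal))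
    {c t₀ δ : ℝ} (hc : 0 < c) (ht : 0 < t₀) (hfc : S + c ≤ f fun _ => t₀) (hδ₀ : 0 < δ)
    (hδ : ∀ v ∈ Γ, ∀ j, v j < 0 → 2 * δ * ∑ i, dlam f v i < dlam f v j)
    (H : IsSolution Γ f f₀ S K r Ω ψ u) (hr : 0 < r) {M : ℝ}
    (hM : IsLUB (u '' Metric.ball 0 r) M) {C₁ C₂ θ : ℝ}
    (hC₁ : C₁ = 2 * t₀ / c * (|S - f₀| + 2 * K)) (hθ : 20 ≤ θ)
    (hθδ : 2000 * (1 + C₁) ≤ θ * δ) (hC₂ : 64 ≤ C₂) (hC₂δ : 100000 * (1 + C₁) ≤ C₂ * δ)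
    (hC₂θ : 100 * θ ^ 4 ≤ C₂) (hC₂C : 100 * C₁ * θ ^ 2 ≤ C₂) :
    Real.log (max 1 ‖gradient u 0‖) < 2 * (C₂ * (1 + M + M ^ 2 / (r / 2) ^ 2)) := by
  by_contra! hcon
  -- Nothing is assumed on the boundary of the ball, so the cutoff lives on a smaller closed ball.
  set R := r / 2 with hRdef
  set N := C₂ * (1 + M + M ^ 2 / R ^ 2) with hN
  have hR : 0 < R := by positivity
  have h0 : (0 : EuclideanSpace ℝ (Fin n)) ∈ Metric.ball (0 : EuclideanSpace ℝ (Fin n)) r :=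
    Metric.mem_ball_self hr
  have hle : ∀ x ∈ Metric.ball (0 : EuclideanSpace ℝ (Fin n)) r, u x ≤ M := fun x hx =>
    hM.1 (mem_image_of_mem u hx)
  have hM0 : 0 < M := (H.pos 0 h0).trans_le (hle 0 h0)
  have hK : 0 ≤ K := (norm_nonneg _).trans (H.norm_fderiv_le 0 h0)
  have hC₁0 : 0 ≤ C₁ := by rw [hC₁]; positivity
  have hN64 : 64 ≤ N := by
    have : 0 ≤ M ^ 2 / R ^ 2 := by positivity
    rw [hN]
    nlinarith
  have hsub : Metric.closedBall (0 : EuclideanSpace ℝ (Fin n)) R ⊆ Metric.ball 0 r :=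
    Metric.closedBall_subset_ball (by rw [hRdef]; linarith)
  -- The truncation at `1` keeps the logarithm continuous and nonnegative where `Du` vanishes; it is
  -- inactive at the maximum point.
  set lg : EuclideanSpace ℝ (Fin n) → ℝ := fun y => Real.log (max 1 ‖gradient u y‖) with hlg
  set Q₁ : EuclideanSpace ℝ (Fin n) → ℝ := fun y => cutoff R y ^ 2 * lg y with hQ₁
  set Q₂ : EuclideanSpace ℝ (Fin n) → ℝ := fun y =>
    cutoff R y ^ 2 * ((1 + √(u y / M)) * lg y - θ) with hQ₂
  set Q : EuclideanSpace ℝ (Fin n) → ℝ := fun y => max (Q₁ y) (Q₂ y) with hQ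
  have hlgc : ContinuousOn lg (Metric.closedBall 0 R) := by
    have h1 : ContinuousOn (fun y => max 1 ‖gradient u y‖) (Metric.closedBall 0 R) :=
      continuousOn_const.sup ((H.continuousOn_gradient.mono hsub).norm)
    exact h1.log fun y _ => by positivity
  have huc : ContinuousOn u (Metric.closedBall 0 R) := H.contDiffOn.continuousOn.mono hsub
  have hcut : ContinuousOn (fun y : EuclideanSpace ℝ (Fin n) => cutoff R y ^ 2)
      (Metric.closedBall 0 R) := ((continuous_cutoff R).pow 2).continuousOn
  have hQc : ContinuousOn Q (Metric.closedBall 0 R) := by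
    refine (hcut.mul hlgc).sup (hcut.mul (((continuousOn_const.add ?_).mul hlgc).sub
      continuousOn_const))
    exact (huc.div_const M).sqrt
  obtain ⟨x, hxR, hxmax⟩ := (isCompact_closedBall (0 : EuclideanSpace ℝ (Fin n)) R).exists_isMaxOn
    ⟨0, Metric.mem_closedBall_self hR.le⟩ hQc
  have hxr := hsub hxR
  have hux := H.pos x hxr
  have hQ0 : 2 * N ≤ Q x := by
    refine le_trans ?_ (hxmax (Metric.mem_closedBall_self hR.le))
    refine le_trans ?_ (le_max_left _ _)
    simp only [hQ₁, cutoff, norm_zero]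
    simpa using hcon
  have hηnn : 0 ≤ cutoff R x := by
    rw [cutoff, sub_nonneg, div_le_one (by positivity)]
    exact pow_le_pow_left₀ (norm_nonneg _) (mem_closedBall_zero_iff.1 hxR) 2
  have hη : 0 < cutoff R x := by
    rcases hηnn.lt_or_eq with h | h
    · exact h
    · have : Q x = 0 := by simp [hQ, hQ₁, hQ₂, ← h]
      linarith
  have hη1 : cutoff R x ≤ 1 := cutoff_le_one R x
  have hxRlt : x ∈ Metric.ball (0 : EuclideanSpace ℝ (Fin n)) R :=
    mem_ball_zero_iff.2 (norm_le_of_cutoff_pos hR hη)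
  have hloc : IsLocalMax Q x := by
    filter_upwards [Metric.isOpen_ball.mem_nhds hxRlt] with y hy
    exact hxmax (Metric.ball_subset_closedBall hy)
  set σ := √(u x / M) with hσdef
  have hσ : 0 < σ := Real.sqrt_pos.2 (by positivity)
  have hσ2 : σ ^ 2 = u x / M := Real.sq_sqrt (by positivity)
  have hσU : σ ^ 2 * M = u x := by rw [hσ2]; field_simp
  have hσ1 : σ ≤ 1 := by
    rw [hσdef, ← Real.sqrt_one]
    exact Real.sqrt_le_sqrt ((div_le_one hM0).2 (hle x hxr))
  set L := lg x with hLdef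
  have hL0 : 0 ≤ L := Real.log_nonneg (le_max_left _ _)
  have hη2 : 0 < cutoff R x ^ 2 := by positivity
  have hηL : N ≤ L * cutoff R x ^ 2 := by
    have h1 : Q x ≤ cutoff R x ^ 2 * (2 * L) := by
      refine max_le ?_ ?_
      · exact mul_le_mul_of_nonneg_left (by linarith) hη2.le
      · refine mul_le_mul_of_nonneg_left ?_ hη2.le
        change (1 + σ) * L - θ ≤ 2 * L
        nlinarith
    linarith
  have hL64 : 64 ≤ L := by
    have : cutoff R x ^ 2 ≤ 1 := pow_le_one₀ hηnn hη1
    have := mul_le_of_le_one_right hL0 this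
    linarith
  set p := ‖gradient u x‖ with hpdef
  have hLlog : L = Real.log p := by
    have h1 : 1 < max 1 p := by
      by_contra! h
      have : max 1 p = 1 := le_antisymm h (le_max_left _ _)
      have : L = 0 := by rw [hLdef, hlg]; simp only; rw [← hpdef, this, Real.log_one]
      linarith
    have h2 : max 1 p = p := max_eq_right ((lt_max_iff.1 h1).resolve_left (lt_irrefl _)).le
    rw [hLdef, hlg]; simp only; rw [← hpdef, h2]
  have hp0 : 0 < p := by
    rcases (norm_nonneg (gradient u x)).lt_or_eq with h | h
    · exact h
    · rw [hpdef, ← h, Real.log_zero] at hLlog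
      linarith
  have hpL : L + 1 ≤ p := by
    have := Real.log_le_sub_one_of_pos hp0
    linarith
  have hp2 : 2 ≤ p := by linarith
  set e : EuclideanSpace ℝ (Fin n) := p⁻¹ • gradient u x with hedef
  have he : ‖e‖ = 1 := by
    rw [hedef, norm_smul, Real.norm_of_nonneg (by positivity), ← hpdef, inv_mul_cancel₀ hp0.ne']
  have hq : gradient u x = p • e := by
    rw [hedef, smul_smul, mul_inv_cancel₀ hp0.ne', one_smul]
  have hw := wFac_pos u x
  have hw2 := wFac_sq_of_gradient_eq he hq
  have hpw : 4 / 5 ≤ p / wFac u x := by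
    rw [div_le_div_iff₀ (by norm_num) hw]
    nlinarith
  have hu := H.contDiffAt hxr
  -- Which function attains the maximum is decided by the sign of `L * σ - θ`, and the attaining one
  -- has a local maximum itself.
  rcases le_total (Q₂ x) (Q₁ x) with hcase | hcase
  · have hQx : Q x = Q₁ x := max_eq_left hcase
    have hsw : L * σ ≤ θ := by
      have h1 : cutoff R x ^ 2 * ((1 + σ) * L - θ) ≤ cutoff R x ^ 2 * L := hcase
      have := le_of_mul_le_mul_left h1 hη2
      linarith
    have hmax := isLocalMax_of_le (φ := fun _ => 1) (θ := 0) (R := R) hu hux he (by linarith) hq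
      (fun _ _ => zero_le_one) hloc
      (fun y => by simp only [one_mul, sub_zero]; exact le_max_left _ _)
      (by rw [hQx, ← hLlog]; simp only [one_mul, sub_zero]; rfl)
    obtain ⟨SV, y, hSV, -, -, hkey⟩ := H.key_inequality hΓ hf hf₀ hc ht hfc hδ₀ hδ hxr hp2 he hq hR hη
      (hasJetAt_const 1 (u x)) zero_lt_one le_rfl le_rfl
      (by simp only [one_mul, sub_zero]; rw [← hLlog]; linarith) hmax
      (Λ := L) (ω := 0) (κ := 0) (by rw [hLlog]; ring) (by ring) (by ring) hC₁ hLlog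
    refine false_of_slow_regime hux hM0 hR hη hη1 hC₁0 hN (by linarith) hC₂θ hC₂C hηL (θ := θ) ?_ ?_
    · have h1 : (L * σ) ^ 2 ≤ θ ^ 2 := pow_le_pow_left₀ (by positivity) hsw 2
      have h2 := mul_le_mul_of_nonneg_right h1 hM0.le
      calc u x * L ^ 2 = (L * σ) ^ 2 * M := by rw [← hσU]; ring
        _ ≤ θ ^ 2 * M := h2
    · have : 0 ≤ u x / 4 * SV := by positivity
      linarith
  · have hQx : Q x = Q₂ x := max_eq_right hcase
    have hsw : θ ≤ L * σ := by
      have h1 : cutoff R x ^ 2 * L ≤ cutoff R x ^ 2 * ((1 + σ) * L - θ) := hcase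
      have := le_of_mul_le_mul_left h1 hη2
      linarith
    have hmax := isLocalMax_of_le (φ := fun s => 1 + √(s / M)) (θ := θ) (R := R) hu hux he
      (by linarith) hq (fun _ _ => by positivity) hloc (fun y => le_max_right _ _)
      (by rw [hQx, ← hLlog])
    have hjet := hasJetAt_one_add_sqrt hM0 hux
    rw [← hσdef] at hjet
    have hZ : 0 < (1 + σ) * L - θ := by linarith
    obtain ⟨SV, y, hSV, hy, hX, hkey⟩ := H.key_inequality hΓ hf hf₀ hc ht hfc hδ₀ hδ hxr hp2 he hq hR
      hη hjet (by positivity) (by positivity) (neg_nonpos.2 (by positivity))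
      (by rw [← hLlog]; exact hZ) hmax (Λ := ((1 + σ) * L - θ) / (1 + σ))
      (ω := σ / (2 * u x) / (1 + σ)) (κ := σ / (4 * u x ^ 2) / (1 + σ))
      (by rw [← hLlog]) rfl (by rw [neg_neg]) hC₁ hLlog
    refine false_of_fast_regime hux hM0 hR hη hη1 hC₁0 hδ₀ hN hC₂ hC₂δ hθ hθδ hηL hσ hσ1 hσU hsw
      hp0 (by linarith) hw hpw rfl rfl ?_ hSV hy hX hkey
    rw [div_le_iff₀ (by positivity)]
    linarith

end GradientBound

end HypGrad

end

theorem mainTheorem1 (n : ℕ) (hn : 1 ≤ n)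
    (Γ : Set (Fin n → ℝ)) (hΓ : HypGrad.IsSymmCone Γ)
    (f : (Fin n → ℝ) → ℝ) (hf : HypGrad.IsCurvatureFunction Γ f)
    (f₀ : ℝ) (hf₀ : limsup (fun v => ((f v : ℝ) : EReal)) (𝓝[Γ] 0) = (f₀ : EReal))
    (S : ℝ) (hS : HypGrad.DiagLimitGT f S) (K : ℝ) :
    ∃ C : ℝ, 0 < C ∧
      ∀ (r : ℝ), 0 < r →
      ∀ (Ω : Set (EuclideanSpace ℝ (Fin n) × ℝ × EuclideanSpace ℝ (Fin (n + 1))))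
        (ψ : EuclideanSpace ℝ (Fin n) × ℝ × EuclideanSpace ℝ (Fin (n + 1)) → ℝ),
        IsOpen Ω → ContDiffOn ℝ 1 ψ Ω →
        (∀ p ∈ Ω, 0 < p.2.1 → 0 ≤ fderiv ℝ ψ p (0, 1, 0) - (ψ p - f₀) / p.2.1) →
      ∀ (u : EuclideanSpace ℝ (Fin n) → ℝ) (M : ℝ),
        ContDiffOn ℝ 3 u (Metric.ball 0 r) →
        (∀ x ∈ Metric.ball (0 : EuclideanSpace ℝ (Fin n)) r, 0 < u x) →
        IsLUB (u '' Metric.ball 0 r) M →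
        (∀ x ∈ Metric.ball (0 : EuclideanSpace ℝ (Fin n)) r, HypGrad.jet u x ∈ Ω) →
        (∀ x ∈ Metric.ball (0 : EuclideanSpace ℝ (Fin n)) r, ψ (HypGrad.jet u x) ≤ S) →
        (∀ x ∈ Metric.ball (0 : EuclideanSpace ℝ (Fin n)) r,
          ‖fderiv ℝ ψ (HypGrad.jet u x)‖ ≤ K) →
        (∀ x ∈ Metric.ball (0 : EuclideanSpace ℝ (Fin n)) r,
          HypGrad.curvatures u x ∈ closure Γ) →
        (∀ x ∈ Metric.ball (0 : EuclideanSpace ℝ (Fin n)) r,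
          HypGrad.extVal Γ f (HypGrad.curvatures u x) =
            ((ψ (HypGrad.jet u x) : ℝ) : EReal)) →
        ((∀ x ∈ Metric.ball (0 : EuclideanSpace ℝ (Fin n)) r, HypGrad.curvatures u x ∈ Γ) ∨
          ∃ (g : (Fin n → ℝ) → ℝ) (h : ℝ → ℝ), HypGrad.IsAuxPair Γ f g h) →
        ‖gradient u 0‖ ≤ Real.exp (C * (M + M ^ 2 / r ^ 2 + 1)) := by
  obtain ⟨δ, hδ₀, -, hδ⟩ := hf.neg_deriv
  obtain ⟨ℓ, hℓ, hSℓ⟩ := hS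
  obtain ⟨t₀, ht, ht₀⟩ :=
    ((hℓ.eventually (lt_mem_nhds hSℓ)).and (eventually_gt_atTop (0 : ℝ))).exists
  have hSt : S < f fun _ => t₀ := EReal.coe_lt_coe_iff.1 ht
  set c := (f fun _ => t₀) - S with hc
  have hc₀ : 0 < c := sub_pos.2 hSt
  -- `C₁` is chosen before any solution is given, so the sign of `K` is not yet known; `max K 0`
  -- keeps it nonnegative.
  set C₁ := 2 * t₀ / c * (|S - f₀| + 2 * max K 0) with hC₁
  have hC₁₀ : 0 ≤ C₁ := by positivity
  set θ := 20 + 2000 * (1 + C₁) / δ with hθ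
  have hθ₀ : 0 ≤ 2000 * (1 + C₁) / δ := by positivity
  set C₂ := 64 + 100000 * (1 + C₁) / δ + 100 * θ ^ 4 + 100 * C₁ * θ ^ 2 with hC₂
  have h₁ : 0 ≤ 100000 * (1 + C₁) / δ := by positivity
  have h₂ : 0 ≤ 100 * θ ^ 4 := by positivity
  have h₃ : 0 ≤ 100 * C₁ * θ ^ 2 := by positivity
  have hC₂₀ : 0 < C₂ := by positivity
  -- The factor `8` is `2` from the bound on the logarithm times `4` from the radius `r / 2`.
  refine ⟨8 * C₂, by positivity, ?_⟩
  intro r hr Ω ψ hΩ hψ hψu u M hu hpos hM hjet hψS hψK hcl heqn _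
  have H : HypGrad.IsSolution Γ f f₀ S (max K 0) r Ω ψ u :=
    { isOpen := hΩ
      contDiffOn_rhs := hψ
      deriv_height := hψu
      contDiffOn := hu
      pos := hpos
      jet_mem := hjet
      rhs_le := hψS
      norm_fderiv_le := fun x hx => (hψK x hx).trans (le_max_left _ _)
      curvatures_mem := hcl
      eqn := heqn }
  have hlog := H.log_gradient_lt hΓ hf hf₀ hc₀ ht₀ (by rw [hc]; linarith) hδ₀ hδ hr hM
    hC₁ (θ := θ) (C₂ := C₂) (by linarith)
    (by rw [hθ, add_mul, div_mul_cancel₀ _ hδ₀.ne']; linarith) (by linarith)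
    ((div_le_iff₀ hδ₀).1 (by linarith)) (by linarith) (by linarith)
  have h₀ : (0 : EuclideanSpace ℝ (Fin n)) ∈ Metric.ball (0 : EuclideanSpace ℝ (Fin n)) r :=
    Metric.mem_ball_self hr
  have hM₀ : 0 < M := (hpos 0 h₀).trans_le (hM.1 (mem_image_of_mem u h₀))
  have hle : 2 * (C₂ * (1 + M + M ^ 2 / (r / 2) ^ 2)) ≤ 8 * C₂ * (M + M ^ 2 / r ^ 2 + 1) := by
    have h₄ : M ^ 2 / (r / 2) ^ 2 = 4 * (M ^ 2 / r ^ 2) := by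
      field_simp
      norm_num
    rw [h₄]
    have h₅ : 0 ≤ C₂ * (1 + M) := by positivity
    linarith
  calc ‖gradient u 0‖ ≤ max 1 ‖gradient u 0‖ := le_max_right _ _
    _ = Real.exp (Real.log (max 1 ‖gradient u 0‖)) := (Real.exp_log (by positivity)).symm
    _ ≤ _ := Real.exp_le_exp.2 (hlog.le.trans hle)
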